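/- Let $A_0=\mathbb F_2[a_1,a_3]$ with $|a_1|=2$, $|a_3|=6$, and let $\Gamma_0=A_0[s,t]/(\rho_1,\rho_2)$ with $|s|=2$, $|t|=6$, where, with $r=s^2+a_1s$, $$\rho_1=s^4+a_1s^3+a_1t+a_3s,\qquad \rho_2=s^6+t^2+a_1s^5+a_1s^2t+a_1^2s^4+a_1^2st+a_1^3s^3+a_3t.$$ This is the mod $2$ reduction of the $2$-local elliptic curve Hopf algebroid after elimination of $a_2,a_4,a_6$; its structure maps are $\eta_R(a_1)=a_1$, $\eta_R(a_3)=a_3+a_1r$, $\psi(s)=s\otimes1+1\otimes s$, $\psi(t)=t\otimes1+1\otimes t+s\otimes r$. Let $H^{n,m}=H^{n,m}(A_0,\Gamma_0)$ be its cohomology (that of the cobar complex, with $n$ the cohomological and $m$ the internal degree). It is the target of the algebraic Bockstein spectral sequence $H^{*,*}\big((A_0,\Gamma_0)/(a_1)\big)[a_1]\Rightarrow H^{*,*}(A_0,\Gamma_0)$. Consider the following classes. * $a_1\in H^{0,2}$, $h_1=[s]\in H^{1,2}$, $h_2=[s^2+a_1s]\in H^{1,4}$. * $x\in H^{1,8}$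 is the class of the cocycle $[a_3s+a_1t']$, where $t'=t+sr$ (so that $d[t']=[r|s]$); it is an element of $\langle a_1,h_2,h_1\rangle$. Put $d=x^2\in H^{2,16}$. * $\Delta=a_3^4+a_1^3a_3^3\in H^{0,24}$ is the discriminant. Then the following (exotic) multiplicative extensions hold in the ring $H^{*,*}(A_0,\Gamma_0)$. 1. $x h_2=a_1xh_1$. 2. $d h_2=a_1dh_1$. 3. The Massey product $\langle x,a_1^2,h_2\rangle\subseteq H^{1,16}$ consists of exactly one class $y$, and $y h_1=a_1 d$. 4. There is a class $g\in H^{4,24}$ lifting the polynomial generator of $H^{*,*}\big((A_0,\Gamma_0)/(a_1,a_3)\big)$ that is represented by $[t|t|t|t]$ plus terms of higher filtration with respect to the ideal $(s^2)$ (that is, $g$ has a representing cocycle congruent to $[t|t|t|t]$ modulo $a_1$, $a_3$ and the squares of the elements $s$ of the four tensor factors), such that $$a_1^4g=\Delta h_1^4 \qquad\text{and}\qquad g\,a_1^2\in\langle h_1,dh_1,x\rangle .$$ -/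

import Mathlib

/-!
The Hopf algebroid `(A₀, Γ₀)` over `𝔽₂`: `A₀ = 𝔽₂[a₁, a₃]`,
`Γ₀ = A₀[s, t] / (rel₁, rel₂)`, right unit `η_R a₁ = a₁`, `η_R a₃ = a₃ + a₁ r` with
`r = s² + a₁ s`, coproduct `ψ s = s ⊗ 1 + 1 ⊗ s`, `ψ t = t ⊗ 1 + 1 ⊗ t + s ⊗ r`; its cobar
complex as a bigraded differential graded algebra; the cohomology ring `H^{*,*}(A₀, Γ₀)`; triple
Massey products in it; and the classes `a₁, h₁, h₂, x, d, Δ`.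
-/

noncomputable section

/-! ### Differential graded rings of characteristic two -/

/-- A differential ring of characteristic two. Since `2 = 0`, the Leibniz rule carries no sign and
can be stated without reference to a grading. -/
class DGRing₂ (R : Type*) [Ring R] where
  diff : R →+ R
  two_eq_zero : (2 : R) = 0
  diff_mul : ∀ a b : R, diff (a * b) = diff a * b + a * diff b
  diff_diff : ∀ a : R, diff (diff a) = 0

namespace DGRing₂

variable (R : Type*) [Ring R] [DGRing₂ R]

theorem diff_one : diff (1 : R) = 0 := by
  have h := diff_mul (1 : R) 1
  simpa using h

/-- The ring of cocycles. -/
def cocycles : Subring R where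
  carrier := {a | diff a = 0}
  mul_mem' {a b} ha hb := by
    simp only [Set.mem_ofPred_eq] at *
    rw [diff_mul, ha, hb]; simp
  one_mem' := diff_one R
  add_mem' {a b} ha hb := by
    simp only [Set.mem_ofPred_eq] at *
    rw [map_add, ha, hb, add_zero]
  zero_mem' := map_zero _
  neg_mem' {a} ha := by
    simp only [Set.mem_ofPred_eq] at *
    rw [map_neg, ha, neg_zero]

/-- The two-sided ideal of coboundaries in the ring of cocycles. -/
def coboundaries : TwoSidedIdeal (cocycles R) :=
  TwoSidedIdeal.mk' {z | ∃ w : R, diff w = z}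
    ⟨0, by simp⟩
    (by rintro _ _ ⟨v, hv⟩ ⟨w, hw⟩; exact ⟨v + w, by simp [hv, hw]⟩)
    (by rintro _ ⟨v, hv⟩; exact ⟨-v, by simp [hv]⟩)
    (by
      rintro ⟨a, ha⟩ _ ⟨w, hw⟩
      have ha : diff a = 0 := ha
      exact ⟨a * w, by rw [diff_mul, ha, hw]; simp⟩)
    (by
      rintro _ ⟨a, ha⟩ ⟨w, hw⟩
      have ha : diff a = 0 := ha
      exact ⟨w * a, by rw [diff_mul, ha, hw]; simp⟩)

/-- The cohomology ring: cocycles modulo coboundaries. -/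
abbrev Cohomology : Type _ := (coboundaries R).ringCon.Quotient

variable {R}

/-- The cohomology class of a cocycle. -/
def cls (a : R) (ha : diff a = 0) : Cohomology R :=
  (coboundaries R).ringCon.mk' ⟨a, ha⟩

end DGRing₂

/-! ### The Hopf algebroid -/

namespace EllCobar

section Formulas

variable {R : Type*} [CommRing R]

/-- The element `r` of `Γ₀`, that is `(s² + a₁ s) / 3` modulo `2`. -/
def rr (a₁ s : R) : R := s ^ 2 + a₁ * s

/-- The first relation of `Γ₀`, that is
`s⁴ - 6 s t + a₁ s³ - 3 a₁ t - 3 a₃ s` modulo `2`. -/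
def rel₁ (a₁ a₃ s t : R) : R := s ^ 4 + a₁ * s ^ 3 + a₁ * t + a₃ * s

/-- The second relation of `Γ₀`, that is
`s⁶ - 27 t² + 3 a₁ s⁵ - 9 a₁ s² t + 3 a₁² s⁴ - 9 a₁² s t + a₁³ s³ - 27 a₃ t` modulo `2`. -/
def rel₂ (a₁ a₃ s t : R) : R :=
  s ^ 6 + t ^ 2 + a₁ * s ^ 5 + a₁ * s ^ 2 * t + a₁ ^ 2 * s ^ 4 + a₁ ^ 2 * s * t
    + a₁ ^ 3 * s ^ 3 + a₃ * t

/-- The value of `a₃` after applying the first `i` coordinate changes of a string with parameters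
`s 0, s 1, …`, that is, the `i`-fold iterated right unit of `a₃`. -/
def stage (a₁ a₃ : R) (s : ℕ → R) : ℕ → R
  | 0 => a₃
  | i + 1 => stage a₁ a₃ s i + a₁ * rr a₁ (s i)

/-- The data `(a₁, a₃, s, t)` form a string
`C₀ → C₁ → C₂ → ⋯` of composable morphisms of the groupoid that `(A₀, Γ₀)` represents: the curve
`Cᵢ` has parameters `(a₁, stage i)`, and the morphism `Cᵢ → Cᵢ₊₁` has parameters `(s i, t i)`. -/
def IsString (a₁ a₃ : R) (s t : ℕ → R) : Prop :=
  ∀ i, rel₁ a₁ (stage a₁ a₃ s i) (s i) (t i) = 0 ∧ rel₂ a₁ (stage a₁ a₃ s i) (s i) (t i) = 0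

end Formulas

/-- Polynomial generators. -/
inductive Gen : Type
  | a₁ : Gen
  | a₃ : Gen
  | s (i : ℕ) : Gen
  | t (i : ℕ) : Gen

/-- The internal degrees `|a₁| = 2`, `|a₃| = 6`, `|s| = 2`, `|t| = 6`. -/
def Gen.weight : Gen → ℕ
  | a₁ => 2
  | a₃ => 6
  | s _ => 2
  | t _ => 6

open MvPolynomial in
/-- The relations that make the generators the parameters of a string. -/
def relIdeal : Ideal (MvPolynomial Gen (ZMod 2)) :=
  Ideal.span
    (Set.range (fun i : ℕ =>
        rel₁ (X Gen.a₁) (stage (X Gen.a₁) (X Gen.a₃) (fun j => X (Gen.s j)) i)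
          (X (Gen.s i)) (X (Gen.t i))) ∪
      Set.range (fun i : ℕ =>
        rel₂ (X Gen.a₁) (stage (X Gen.a₁) (X Gen.a₃) (fun j => X (Gen.s j)) i)
          (X (Gen.s i)) (X (Gen.t i))))

/-- The ring that represents infinite composable strings. It is the union of the rings
`cochains n` below. -/
def Str : Type := MvPolynomial Gen (ZMod 2) ⧸ relIdeal

instance : CommRing Str := inferInstanceAs (CommRing (MvPolynomial Gen (ZMod 2) ⧸ relIdeal))

instance : Algebra (ZMod 2) Str :=
  inferInstanceAs (Algebra (ZMod 2) (MvPolynomial Gen (ZMod 2) ⧸ relIdeal))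

/-- The projection from the polynomial ring. -/
def proj : MvPolynomial Gen (ZMod 2) →ₐ[ZMod 2] Str := Ideal.Quotient.mkₐ (ZMod 2) relIdeal

/-- The image of a generator. -/
def gen (v : Gen) : Str := proj (MvPolynomial.X v)

/-- `Γ₀ ⊗_{A₀} ⋯ ⊗_{A₀} Γ₀` (`n` factors; `A₀` for `n = 0`), as the subring of `Str` generated by
`a₁`, `a₃` and `s i`, `t i` for `i < n`. Here `s i`, `t i` are the elements `s`, `t` of the `i`-th
tensor factor, and the coefficient `a₃` of the `i`-th factor is `stage i`, so that
`[γ₀ | γ₁ | ⋯]` is the product of the `γᵢ (a₁, stage i, s i, t i)`. (Setting `s i = t i = 0` for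
`i ≥ n` shows that there are no relations in `cochains n` beyond those with `i < n`.) -/
def cochains (n : ℕ) : Subalgebra (ZMod 2) Str :=
  Algebra.adjoin (ZMod 2)
    ({gen Gen.a₁, gen Gen.a₃} ∪ {f | ∃ i < n, f = gen (Gen.s i) ∨ f = gen (Gen.t i)})

section Lift

section

variable {R S : Type*} [CommRing R] [CommRing S] (φ : R →+* S)

theorem map_rr (a s : R) : φ (rr a s) = rr (φ a) (φ s) := by simp [rr]

theorem map_stage (a b : R) (s : ℕ → R) (i : ℕ) :
    φ (stage a b s i) = stage (φ a) (φ b) (fun j => φ (s j)) i := by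
  induction i with
  | zero => rfl
  | succ i ih => simp [stage, ih, map_rr]

theorem map_rel₁ (a b s t : R) : φ (rel₁ a b s t) = rel₁ (φ a) (φ b) (φ s) (φ t) := by
  simp [rel₁]

theorem map_rel₂ (a b s t : R) : φ (rel₂ a b s t) = rel₂ (φ a) (φ b) (φ s) (φ t) := by
  simp [rel₂]

end

variable {R : Type*} [CommRing R] [Algebra (ZMod 2) R]

/-- The values of a string on the generators. -/
def Gen.val (b₁ b₃ : R) (u v : ℕ → R) : Gen → R
  | a₁ => b₁
  | a₃ => b₃
  | s i => u i
  | t i => v i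

/-- The ring homomorphism classified by a string. -/
def lift (b₁ b₃ : R) (u v : ℕ → R) (h : IsString b₁ b₃ u v) : Str →ₐ[ZMod 2] R :=
  Ideal.Quotient.liftₐ relIdeal (MvPolynomial.aeval (Gen.val b₁ b₃ u v)) (by
    intro p hp
    rw [← RingHom.mem_ker]
    have hle : relIdeal ≤ RingHom.ker (MvPolynomial.aeval (R := ZMod 2) (Gen.val b₁ b₃ u v)) := by
      rw [relIdeal, Ideal.span_le]
      rintro _ (⟨i, rfl⟩ | ⟨i, rfl⟩)
      · have := (h i).1
        simp only [SetLike.mem_coe, RingHom.mem_ker]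
        rw [← AlgHom.coe_toRingHom, map_rel₁, map_stage]
        simpa [Gen.val] using this
      · have := (h i).2
        simp only [SetLike.mem_coe, RingHom.mem_ker]
        rw [← AlgHom.coe_toRingHom, map_rel₂, map_stage]
        simpa [Gen.val] using this
    exact hle hp)

@[simp] theorem lift_gen (b₁ b₃ : R) (u v : ℕ → R) (h : IsString b₁ b₃ u v) (w : Gen) :
    lift b₁ b₃ u v h (gen w) = Gen.val b₁ b₃ u v w :=
  MvPolynomial.aeval_X _ w

theorem algHom_ext {φ ψ : Str →ₐ[ZMod 2] R} (h : ∀ v, φ (gen v) = ψ (gen v)) : φ = ψ := by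
  apply Ideal.Quotient.algHom_ext
  apply MvPolynomial.algHom_ext
  intro v
  exact h v

end Lift

/-- The element `stage i` of `Str`. -/
def st (i : ℕ) : Str := stage (gen Gen.a₁) (gen Gen.a₃) (fun j => gen (Gen.s j)) i

theorem isString_gen : IsString (gen Gen.a₁) (gen Gen.a₃)
    (fun j => gen (Gen.s j)) (fun j => gen (Gen.t j)) := by
  intro i
  constructor
  · have : (proj : MvPolynomial Gen (ZMod 2) →+* Str) _ = 0 := Ideal.Quotient.eq_zero_iff_mem.2
      (Ideal.subset_span (Or.inl ⟨i, rfl⟩))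
    rw [map_rel₁, map_stage] at this
    exact this
  · have : (proj : MvPolynomial Gen (ZMod 2) →+* Str) _ = 0 := Ideal.Quotient.eq_zero_iff_mem.2
      (Ideal.subset_span (Or.inr ⟨i, rfl⟩))
    rw [map_rel₂, map_stage] at this
    exact this

theorem two_eq_zero : (2 : Str) = 0 := by
  have h : algebraMap (ZMod 2) Str 2 = 0 := by
    rw [show (2 : ZMod 2) = 0 from rfl, map_zero]
  rwa [map_ofNat] at h

theorem add_self (f : Str) : f + f = 0 := by
  linear_combination f * two_eq_zero

/-! ### Cofaces -/

theorem stage_shift {R : Type*} [CommRing R] (a₁ a₃ : R) (s : ℕ → R) (p i : ℕ) :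
    stage a₁ (stage a₁ a₃ s p) (fun k => s (k + p)) i = stage a₁ a₃ s (i + p) := by
  induction i with
  | zero => simp [stage]
  | succ i ih =>
    rw [show i + 1 + p = (i + p) + 1 by omega]
    simp only [stage, ih]

/-- Discard the first `p` morphisms of a string: this is `f ↦ 1 ⊗ ⋯ ⊗ 1 ⊗ f`. -/
def shift (p : ℕ) : Str →ₐ[ZMod 2] Str :=
  lift (gen Gen.a₁) (st p) (fun i => gen (Gen.s (i + p))) (fun i => gen (Gen.t (i + p))) (by
    intro i
    have := isString_gen (i + p)
    rwa [← stage_shift] at this)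

/-- The parameter `a₃` of the source after discarding (`j = 0`) the first morphism. -/
def faceA (j : ℕ) : Str := if j = 0 then st 1 else gen Gen.a₃

/-- The parameters `s` after composing the morphisms number `j - 1` and `j` (for `j = 0`:
discarding the first one). -/
def faceS (j i : ℕ) : Str :=
  if i + 1 < j then gen (Gen.s i)
  else if i + 1 = j then gen (Gen.s i) + gen (Gen.s (i + 1))
  else gen (Gen.s (i + 1))

/-- The parameters `t` after composing the morphisms number `j - 1` and `j` (for `j = 0`:
discarding the first one). -/
def faceT (j i : ℕ) : Str :=
  if i + 1 < j then gen (Gen.t i)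
  else if i + 1 = j then
    gen (Gen.t i) + gen (Gen.t (i + 1)) + gen (Gen.s i) * rr (gen Gen.a₁) (gen (Gen.s (i + 1)))
  else gen (Gen.t (i + 1))

theorem rr_add (a f g : Str) : rr a (f + g) = rr a f + rr a g := by
  unfold rr
  linear_combination f * g * two_eq_zero

theorem stage_face (j i : ℕ) :
    stage (gen Gen.a₁) (faceA j) (faceS j) i = if i < j then st i else st (i + 1) := by
  induction i with
  | zero =>
    rcases Nat.eq_zero_or_pos j with rfl | hj
    · simp [stage, faceA]
    · simp [stage, faceA, hj, hj.ne', st]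
  | succ i ih =>
    simp only [stage, ih, faceS]
    rcases lt_trichotomy (i + 1) j with h | h | h
    · rw [if_pos (by omega), if_pos h, if_pos h]; rfl
    · rw [if_pos (by omega), if_neg (by omega), if_pos h, if_neg (by omega), rr_add]
      simp only [st, stage]; ring
    · rw [if_neg (by omega), if_neg (by omega), if_neg (by omega), if_neg (by omega)]; rfl

theorem rel₁_comp (a c s u t v : Str) (h : rel₁ a c s t = 0)
    (h' : rel₁ a (c + a * rr a s) u v = 0) : rel₁ a c (s + u) (t + v + s * rr a u) = 0 := by
  simp only [rel₁, rr] at *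
  linear_combination h + h' +
      (2*s^3*u + 3*s^2*u^2 + 2*s*u^3 + a*s^2*u + 2*a*s*u^2) * two_eq_zero

theorem rel₂_comp (a c s u t v : Str) (h : rel₁ a c s t = 0) (h₂ : rel₂ a c s t = 0)
    (h' : rel₂ a (c + a * rr a s) u v = 0) : rel₂ a c (s + u) (t + v + s * rr a u) = 0 := by
  simp only [rel₁, rel₂, rr] at *
  linear_combination (u ^ 2 + a * u) * h + h₂ + h' +
      (3*s^5*u + 7*s^4*u^2 + 10*s^3*u^3 + 8*s^2*u^4 + 3*s*u^5 + t*v + s*u^2*t + 2*a*s*u*t +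
        s*u^2*v + 2*a*s*u*v + 7*a*s^2*u^3 + 5*a^2*s^2*u^2 + 2*a*s^4*u + 5*a*s^3*u^2 + 3*a*s*u^4
        + 2*a^2*s^3*u + 3*a^2*s*u^3 + 2*a^3*s^2*u + 2*a^3*s*u^2) * two_eq_zero

theorem isString_face (j : ℕ) : IsString (gen Gen.a₁) (faceA j) (faceS j) (faceT j) := by
  intro i
  rw [stage_face]
  have h0 := isString_gen i
  have h1 := isString_gen (i + 1)
  rcases lt_trichotomy (i + 1) j with h | h | h
  · simp only [faceS, faceT]
    rw [if_pos (by omega), if_pos h, if_pos h]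
    exact h0
  · simp only [faceS, faceT]
    rw [if_pos (by omega), if_neg (by omega), if_pos h, if_neg (by omega), if_pos h]
    obtain ⟨h01, h02⟩ := h0
    obtain ⟨h11, h12⟩ := h1
    simp only [stage] at h11 h12
    change rel₁ _ (st i) _ _ = 0 at h01
    change rel₂ _ (st i) _ _ = 0 at h02
    change rel₁ _ (st i + _) _ _ = 0 at h11
    change rel₂ _ (st i + _) _ _ = 0 at h12
    exact ⟨rel₁_comp _ _ _ _ _ _ h01 h11, rel₂_comp _ _ _ _ _ _ h01 h02 h12⟩
  · simp only [faceS, faceT]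
    rw [if_neg (by omega), if_neg (by omega), if_neg (by omega), if_neg (by omega),
      if_neg (by omega)]
    exact h1

/-- The `j`-th coface. On `cochains n` it inserts `1` in front for `j = 0`, applies `ψ` to the
`(j - 1)`-st tensor factor for `1 ≤ j ≤ n`, and for `j = n + 1` it is the inclusion
`f ↦ f ⊗ 1`. -/
def coface (j : ℕ) : Str →ₐ[ZMod 2] Str :=
  lift (gen Gen.a₁) (faceA j) (faceS j) (faceT j) (isString_face j)

@[simp] theorem coface_a₁ (j : ℕ) : coface j (gen Gen.a₁) = gen Gen.a₁ := lift_gen _ _ _ _ _ _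
@[simp] theorem coface_a₃ (j : ℕ) : coface j (gen Gen.a₃) = faceA j := lift_gen _ _ _ _ _ _
@[simp] theorem coface_s (j i : ℕ) : coface j (gen (Gen.s i)) = faceS j i :=
  lift_gen _ _ _ _ _ _
@[simp] theorem coface_t (j i : ℕ) : coface j (gen (Gen.t i)) = faceT j i :=
  lift_gen _ _ _ _ _ _

@[simp] theorem shift_a₁ (p : ℕ) : shift p (gen Gen.a₁) = gen Gen.a₁ := lift_gen _ _ _ _ _ _
@[simp] theorem shift_a₃ (p : ℕ) : shift p (gen Gen.a₃) = st p := lift_gen _ _ _ _ _ _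
@[simp] theorem shift_s (p i : ℕ) : shift p (gen (Gen.s i)) = gen (Gen.s (i + p)) :=
  lift_gen _ _ _ _ _ _
@[simp] theorem shift_t (p i : ℕ) : shift p (gen (Gen.t i)) = gen (Gen.t (i + p)) :=
  lift_gen _ _ _ _ _ _

theorem coface_st (j i : ℕ) : coface j (st i) = if i < j then st i else st (i + 1) := by
  rw [← stage_face, st, ← AlgHom.coe_toRingHom, map_stage]
  simp

theorem shift_st (p i : ℕ) : shift p (st i) = st (i + p) := by
  rw [st, ← AlgHom.coe_toRingHom, map_stage]
  simp only [AlgHom.coe_toRingHom, shift_a₁, shift_a₃, shift_s]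
  exact stage_shift _ _ _ _ _

theorem coface_rr (j : ℕ) (f g : Str) :
    coface j (rr f g) = rr (coface j f) (coface j g) := map_rr (coface j : Str →+* Str) f g

theorem coface_comp {i j : ℕ} (h : i ≤ j) (f : Str) :
    coface (j + 1) (coface i f) = coface i (coface j f) := by
  have : (coface (j + 1)).comp (coface i) = (coface i).comp (coface j) := by
    apply algHom_ext
    rintro (_ | _ | k | k)
    · simp
    · simp only [AlgHom.comp_apply, coface_a₃, faceA]
      rcases Nat.eq_zero_or_pos i with rfl | hi
      · rcases Nat.eq_zero_or_pos j with rfl | hj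
        · simp [coface_st]
        · simp [coface_st, hj, hj.ne', faceA]
      · have hj : j ≠ 0 := by omega
        simp [hi.ne', hj, faceA]
    · simp only [AlgHom.comp_apply, coface_s]
      unfold faceS
      split_ifs <;> first | omega | skip
      all_goals simp only [map_add, coface_s]
      all_goals unfold faceS
      all_goals split_ifs <;> first | omega | rfl | (simp only [add_assoc])
    · simp only [AlgHom.comp_apply, coface_t]
      unfold faceT
      split_ifs <;> first | omega | skip
      all_goals simp only [map_add, map_mul, coface_t, coface_s, coface_rr, coface_a₁]
      all_goals simp only [faceS, faceT]
      all_goals split_ifs <;> first | omega | with_reducible rfl | skip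
      all_goals
        simp only [rr]
        linear_combination
          (gen (Gen.s k) * gen (Gen.s (k + 1)) * gen (Gen.s (k + 1 + 1))) * two_eq_zero
  exact DFunLike.congr_fun this f

theorem shift_comp (p q : ℕ) (f : Str) : shift p (shift q f) = shift (p + q) f := by
  have : (shift p).comp (shift q) = shift (p + q) := by
    apply algHom_ext
    rintro (_ | _ | k | k)
    · simp
    · simp [shift_st, add_comm]
    · simp; congr 2; omega
    · simp; congr 2; omega
  exact DFunLike.congr_fun this f

theorem shift_zero (f : Str) : shift 0 f = f := by
  have : shift 0 = AlgHom.id _ _ := by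
    apply algHom_ext
    rintro (_ | _ | k | k) <;> simp
    rfl
  exact DFunLike.congr_fun this f

theorem coface_zero (f : Str) : coface 0 f = shift 1 f := by
  have : coface 0 = shift 1 := by
    apply algHom_ext
    rintro (_ | _ | k | k) <;> simp [faceA, faceS, faceT]
  exact DFunLike.congr_fun this f

theorem coface_shift_le {j p : ℕ} (h : j ≤ p) (f : Str) :
    coface j (shift p f) = shift (p + 1) f := by
  have : (coface j).comp (shift p) = shift (p + 1) := by
    apply algHom_ext
    rintro (_ | _ | k | k)
    · simp
    · simp [coface_st, Nat.not_lt.2 h]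
    · simp only [AlgHom.comp_apply, shift_s, coface_s, faceS]
      rw [if_neg (by omega), if_neg (by omega), add_assoc]
    · simp only [AlgHom.comp_apply, shift_t, coface_t, faceT]
      rw [if_neg (by omega), if_neg (by omega), add_assoc]
  exact DFunLike.congr_fun this f

theorem coface_shift_add (p k : ℕ) (f : Str) :
    coface (p + (k + 1)) (shift p f) = shift p (coface (k + 1) f) := by
  have : (coface (p + (k + 1))).comp (shift p) = (shift p).comp (coface (k + 1)) := by
    apply algHom_ext
    rintro (_ | _ | i | i)
    · simp
    · simp [coface_st, faceA]
    · simp only [AlgHom.comp_apply, shift_s, coface_s, faceS]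
      split_ifs <;> first | omega | skip
      all_goals simp only [map_add, shift_s]
      all_goals simp only [add_assoc, add_comm]
    · simp only [AlgHom.comp_apply, shift_t, coface_t, faceT]
      split_ifs <;> first | omega | skip
      all_goals simp only [map_add, map_mul, shift_s, shift_t, shift_a₁,
        show ∀ f g : Str, shift p (rr f g) = rr (shift p f) (shift p g) from
          fun f g => map_rr (shift p : Str →+* Str) f g]
      all_goals simp only [show i + 1 + p = i + p + 1 by omega]
  exact DFunLike.congr_fun this f

/-! ### The cobar complex -/

theorem a₁_mem (n : ℕ) : gen Gen.a₁ ∈ cochains n := Algebra.subset_adjoin (by simp)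
theorem a₃_mem (n : ℕ) : gen Gen.a₃ ∈ cochains n := Algebra.subset_adjoin (by simp)
theorem s_mem {i n : ℕ} (h : i < n) : gen (Gen.s i) ∈ cochains n :=
  Algebra.subset_adjoin (Or.inr ⟨i, h, Or.inl rfl⟩)
theorem t_mem {i n : ℕ} (h : i < n) : gen (Gen.t i) ∈ cochains n :=
  Algebra.subset_adjoin (Or.inr ⟨i, h, Or.inr rfl⟩)

theorem rr_mem {n : ℕ} {f g : Str} (hf : f ∈ cochains n) (hg : g ∈ cochains n) :
    rr f g ∈ cochains n := add_mem (pow_mem hg 2) (mul_mem hf hg)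

theorem st_mem {i n : ℕ} (h : i ≤ n) : st i ∈ cochains n := by
  induction i with
  | zero => exact a₃_mem n
  | succ i ih =>
    exact add_mem (ih (by omega)) (mul_mem (a₁_mem n) (rr_mem (a₁_mem n) (s_mem (by omega))))

theorem map_mem {n m : ℕ} (φ : Str →ₐ[ZMod 2] Str) (h₁ : φ (gen Gen.a₁) ∈ cochains m)
    (h₃ : φ (gen Gen.a₃) ∈ cochains m) (hs : ∀ i < n, φ (gen (Gen.s i)) ∈ cochains m)
    (ht : ∀ i < n, φ (gen (Gen.t i)) ∈ cochains m) {f : Str} (hf : f ∈ cochains n) :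
    φ f ∈ cochains m := by
  have : cochains n ≤ (cochains m).comap φ := by
    refine Algebra.adjoin_le ?_
    rintro _ ((rfl | rfl) | ⟨i, hi, (rfl | rfl)⟩)
    exacts [h₁, h₃, hs i hi, ht i hi]
  exact this hf

theorem shift_mem {p q : ℕ} {f : Str} (hf : f ∈ cochains q) : shift p f ∈ cochains (p + q) := by
  refine map_mem (shift p) ?_ ?_ ?_ ?_ hf
  · rw [shift_a₁]; exact a₁_mem _
  · rw [shift_a₃]; exact st_mem (by omega)
  · intro i hi; rw [shift_s]; exact s_mem (by omega)
  · intro i hi; rw [shift_t]; exact t_mem (by omega)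

theorem cochains_mono {n m : ℕ} (h : n ≤ m) {f : Str} (hf : f ∈ cochains n) : f ∈ cochains m :=
  map_mem (AlgHom.id _ _) (a₁_mem m) (a₃_mem m) (fun _ hi => s_mem (lt_of_lt_of_le hi h))
    (fun _ hi => t_mem (lt_of_lt_of_le hi h)) hf

theorem coface_mem (j : ℕ) {n : ℕ} {f : Str} (hf : f ∈ cochains n) :
    coface j f ∈ cochains (n + 1) := by
  refine map_mem (coface j) ?_ ?_ ?_ ?_ hf
  · rw [coface_a₁]; exact a₁_mem _
  · rw [coface_a₃, faceA]; split_ifs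
    exacts [st_mem (by omega), a₃_mem _]
  · intro i hi; rw [coface_s, faceS]
    split_ifs
    exacts [s_mem (by omega), add_mem (s_mem (by omega)) (s_mem (by omega)), s_mem (by omega)]
  · intro i hi; rw [coface_t, faceT]
    split_ifs
    exacts [t_mem (by omega), add_mem (add_mem (t_mem (by omega)) (t_mem (by omega)))
      (mul_mem (s_mem (by omega)) (rr_mem (a₁_mem _) (s_mem (by omega)))), t_mem (by omega)]

theorem coface_of_lt {n j : ℕ} (h : n < j) {f : Str} (hf : f ∈ cochains n) : coface j f = f := by
  have : cochains n ≤ AlgHom.equalizer (coface j) (AlgHom.id (ZMod 2) Str) := by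
    refine Algebra.adjoin_le ?_
    rintro _ ((rfl | rfl) | ⟨i, hi, (rfl | rfl)⟩)
    · simp
    · have : j ≠ 0 := by omega
      simp [faceA, this]
    · have : i + 1 < j := by omega
      simp [faceS, this]
    · have : i + 1 < j := by omega
      simp [faceT, this]
  exact this hf

/-- The cobar differential in degree `n`: the alternating (that is, modulo `2`, plain) sum of the
cofaces. -/
def delta (n : ℕ) (f : Str) : Str := ∑ j ∈ Finset.range (n + 2), coface j f

theorem delta_mem {n : ℕ} {f : Str} (hf : f ∈ cochains n) : delta n f ∈ cochains (n + 1) :=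
  sum_mem fun j _ => coface_mem j hf

theorem delta_delta (n : ℕ) (f : Str) : delta (n + 1) (delta n f) = 0 := by
  simp only [delta, map_sum]
  rw [← Finset.sum_product']
  refine Finset.sum_involution
    (fun p _ => if p.2 < p.1 then (p.2, p.1 - 1) else (p.2 + 1, p.1)) ?_ ?_ ?_ ?_
  · rintro ⟨j, i⟩ -
    by_cases h : i < j
    · obtain ⟨k, rfl⟩ : ∃ k, j = k + 1 := ⟨j - 1, by omega⟩
      simp only [h, if_true, Nat.add_sub_cancel]
      rw [coface_comp (by omega)]
      exact add_self _
    · simp only [h, if_false]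
      rw [coface_comp (by omega)]
      exact add_self _
  · rintro ⟨j, i⟩ - -
    by_cases h : i < j
    · simp only [h, if_true, ne_eq, Prod.mk.injEq]; omega
    · simp only [h, if_false, ne_eq, Prod.mk.injEq]; omega
  · rintro ⟨j, i⟩ hp
    simp only [Finset.mem_product, Finset.mem_range] at hp
    by_cases h : i < j
    · simp only [h, if_true, Finset.mem_product, Finset.mem_range]; omega
    · simp only [h, if_false, Finset.mem_product, Finset.mem_range]; omega
  · rintro ⟨j, i⟩ -
    by_cases h : i < j
    · simp only [h, if_true, show ¬ (j - 1 < i) by omega, if_false]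
      exact Prod.ext (by simp only; omega) rfl
    · simp only [h, if_false, show j < i + 1 by omega, if_true, Nat.add_sub_cancel]

theorem delta_mul {p : ℕ} (q : ℕ) {f : Str} (hf : f ∈ cochains p) (g : Str) :
    delta (p + q) (f * shift p g) = delta p f * shift (p + 1) g + f * shift p (delta q g) := by
  have h1 : delta p f = ∑ j ∈ Finset.range (p + 1), coface j f + f := by
    rw [delta, Finset.sum_range_succ, coface_of_lt (by omega) hf]
  have h2 : delta q g = ∑ k ∈ Finset.range (q + 1), coface (k + 1) g + shift 1 g := by
    rw [delta, Finset.sum_range_succ', coface_zero]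
  have h3 : delta (p + q) (f * shift p g) =
      ∑ j ∈ Finset.range (p + 1), coface j f * shift (p + 1) g +
        ∑ k ∈ Finset.range (q + 1), f * shift p (coface (k + 1) g) := by
    rw [delta, show p + q + 2 = (p + 1) + (q + 1) by omega, Finset.sum_range_add]
    congr 1
    · refine Finset.sum_congr rfl fun j hj => ?_
      rw [Finset.mem_range] at hj
      rw [map_mul, coface_shift_le (by omega)]
    · refine Finset.sum_congr rfl fun k _ => ?_
      rw [map_mul, coface_of_lt (by omega) hf, show p + 1 + k = p + (k + 1) by omega,
        coface_shift_add]
  rw [h1, h2, h3, map_add, map_sum, shift_comp, ← Finset.sum_mul, ← Finset.mul_sum]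
  linear_combination (-(f * shift (p + 1) g)) * two_eq_zero

/-- The cochains of degree `n`. -/
abbrev Cochain (n : ℕ) : Type := cochains n

/-- The cup product is concatenation, `[γ₁ | ⋯ | γ_p] [γ'₁ | ⋯ | γ'_q] = [γ₁ | ⋯ | γ'_q]`. -/
instance : GradedMonoid.GMul Cochain where
  mul {p q} f g := ⟨f.1 * shift p g.1, mul_mem (cochains_mono (by omega) f.2) (shift_mem g.2)⟩

instance : GradedMonoid.GOne Cochain where
  one := ⟨1, one_mem _⟩

instance : GradedMonoid.GMonoid Cochain where
  one_mul f := Sigma.subtype_ext (zero_add _) (by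
    change 1 * shift 0 _ = _
    rw [one_mul, shift_zero])
  mul_one f := Sigma.subtype_ext (add_zero _) (by
    change _ * shift _ 1 = _
    rw [map_one, mul_one])
  mul_assoc f g h := Sigma.subtype_ext (add_assoc _ _ _) (by
    change _ * shift _ _ * shift _ _ = _ * shift _ (_ * shift _ _)
    rw [map_mul, shift_comp, mul_assoc]
    rfl)

instance : DirectSum.GRing Cochain where
  mul_zero f := Subtype.ext (by change f.1 * shift _ 0 = 0; simp)
  zero_mul f := Subtype.ext (by change 0 * shift _ _ = (0 : Str); simp)
  mul_add f g h := Subtype.ext (by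
    change f.1 * shift _ (g.1 + h.1) = f.1 * shift _ g.1 + f.1 * shift _ h.1
    rw [map_add, mul_add])
  add_mul f g h := Subtype.ext (by
    change (f.1 + g.1) * shift _ h.1 = f.1 * shift _ h.1 + g.1 * shift _ h.1
    rw [add_mul])
  natCast n := ⟨(n : Str), natCast_mem _ n⟩
  natCast_zero := Subtype.ext Nat.cast_zero
  natCast_succ n := Subtype.ext (Nat.cast_succ n)
  intCast n := ⟨(n : Str), intCast_mem _ n⟩
  intCast_ofNat n := Subtype.ext (Int.cast_natCast n)
  intCast_negSucc_ofNat n := Subtype.ext (Int.cast_negSucc n)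

open DirectSum in
/-- The cobar complex of `(A₀, Γ₀)`, with its cup product. -/
abbrev Cobar : Type := ⨁ n, Cochain n

/-- The cochain of degree `n` given by an element of `cochains n`. -/
def mk (n : ℕ) (f : Str) (hf : f ∈ cochains n) : Cobar := DirectSum.of Cochain n ⟨f, hf⟩

/-- The cobar differential in degree `n`. -/
def deltaHom (n : ℕ) : Cochain n →+ Cochain (n + 1) where
  toFun f := ⟨delta n f.1, delta_mem f.2⟩
  map_zero' := Subtype.ext (by change delta n 0 = 0; simp [delta])
  map_add' f g := Subtype.ext (by
    change delta n (f.1 + g.1) = delta n f.1 + delta n g.1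
    simp [delta, Finset.sum_add_distrib])

/-- The differential of the cobar complex. -/
def cobarDiff : Cobar →+ Cobar :=
  DirectSum.toAddMonoid fun n => (DirectSum.of Cochain (n + 1)).comp (deltaHom n)

theorem cobarDiff_of (n : ℕ) (f : Cochain n) :
    cobarDiff (DirectSum.of Cochain n f) = DirectSum.of Cochain (n + 1) (deltaHom n f) := by
  simp [cobarDiff]

theorem of_eq {n m : ℕ} (h : n = m) (f : Cochain n) (g : Cochain m) (hfg : f.1 = g.1) :
    DirectSum.of Cochain n f = DirectSum.of Cochain m g :=
  DirectSum.of_eq_of_gradedMonoid_eq (Sigma.subtype_ext h hfg)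

instance : DGRing₂ Cobar where
  diff := cobarDiff
  two_eq_zero := by
    have h : (2 : Cobar) = DirectSum.of Cochain 0 1 + DirectSum.of Cochain 0 1 :=
      one_add_one_eq_two.symm
    rw [h, ← map_add, show (1 : Cochain 0) + 1 = 0 from Subtype.ext (add_self 1), map_zero]
  diff_mul a b := by
    induction a using DirectSum.induction_on with
    | zero => simp
    | add a a' ha ha' => simp only [add_mul, map_add, ha, ha']; abel
    | of p f =>
      induction b using DirectSum.induction_on with
      | zero => simp
      | add b b' hb hb' => simp only [mul_add, map_add, hb, hb']; abel
      | of q g =>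
        rw [DirectSum.of_mul_of, cobarDiff_of, cobarDiff_of, cobarDiff_of, DirectSum.of_mul_of,
          DirectSum.of_mul_of]
        rw [of_eq (show p + 1 + q = p + q + 1 by omega) (GradedMonoid.GMul.mul (deltaHom p f) g)
          ⟨delta p f.1 * shift (p + 1) g.1,
            mul_mem (cochains_mono (by omega) (delta_mem f.2))
              (cochains_mono (by omega) (shift_mem g.2))⟩ rfl,
          of_eq (show p + (q + 1) = p + q + 1 by omega) (GradedMonoid.GMul.mul f (deltaHom q g))
          ⟨f.1 * shift p (delta q g.1),
            mul_mem (cochains_mono (by omega) f.2) (shift_mem (delta_mem g.2))⟩ rfl, ← map_add]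
        exact of_eq rfl _ _ (delta_mul q f.2 g.1)
  diff_diff a := by
    induction a using DirectSum.induction_on with
    | zero => simp
    | add a a' ha ha' => simp only [map_add, ha, ha', add_zero]
    | of p f =>
      rw [cobarDiff_of, cobarDiff_of]
      have : deltaHom (p + 1) (deltaHom p f) = 0 := Subtype.ext (delta_delta p f.1)
      rw [this, map_zero]

open DGRing₂

theorem diff_mk {n : ℕ} {f : Str} (hf : f ∈ cochains n) :
    diff (mk n f hf) = mk (n + 1) (delta n f) (delta_mem hf) := cobarDiff_of n _

theorem diff_mk_eq_zero {n : ℕ} {f : Str} (hf : f ∈ cochains n) (h : delta n f = 0) :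
    diff (mk n f hf) = 0 := by
  rw [diff_mk]
  simp only [h]
  exact map_zero _

/-- The cohomology ring `H^{*,*}(A₀, Γ₀)`. -/
abbrev H : Type := Cohomology Cobar

/-- The elements of `Str` of internal degree `m`. -/
def internal (m : ℕ) : Submodule (ZMod 2) Str :=
  (MvPolynomial.weightedHomogeneousSubmodule (ZMod 2) Gen.weight m).map proj.toLinearMap

/-- The cobar cochains of cohomological degree `n` and internal degree `m`. -/
def bicochains (n m : ℕ) : Set Cobar :=
  {c | ∃ (f : Str) (hf : f ∈ cochains n), f ∈ internal m ∧ mk n f hf = c}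

/-- The cobar cochains of cohomological degree `n - 1` and internal degree `m`; only `0` is of
negative cohomological degree. -/
def bicochainsPred : ℕ → ℕ → Set Cobar
  | 0, _ => {0}
  | n + 1, m => bicochains n m

/-- The triple Massey product `⟨α, β, γ⟩` of classes of bidegrees `p`, `q`, `r`: the set of all
classes of `u c + a v`, where `a, b, c` are bihomogeneous cocycles that represent `α, β, γ` and
`u, v` are bihomogeneous cochains with `d u = a b`, `d v = b c`. (It is empty unless
`α β = 0 = β γ`.) -/
def massey (α β γ : H) (p q r : ℕ × ℕ) : Set H :=
  {ζ | ∃ (a b c : Cobar) (ha : diff a = 0) (hb : diff b = 0) (hc : diff c = 0),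
    a ∈ bicochains p.1 p.2 ∧ b ∈ bicochains q.1 q.2 ∧ c ∈ bicochains r.1 r.2 ∧
    cls a ha = α ∧ cls b hb = β ∧ cls c hc = γ ∧
    ∃ u ∈ bicochainsPred (p.1 + q.1) (p.2 + q.2),
    ∃ v ∈ bicochainsPred (q.1 + r.1) (q.2 + r.2),
      diff u = a * b ∧ diff v = b * c ∧
      ∃ hw : diff (u * c + a * v) = 0, cls (u * c + a * v) hw = ζ}

/-! ### The classes -/

theorem gen_string : rel₁ (gen Gen.a₁) (gen Gen.a₃) (gen (Gen.s 0)) (gen (Gen.t 0)) = 0 ∧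
    rel₂ (gen Gen.a₁) (gen Gen.a₃) (gen (Gen.s 0)) (gen (Gen.t 0)) = 0 := isString_gen 0

theorem delta_a₁ : delta 0 (gen Gen.a₁) = 0 := by
  simp only [delta, Finset.sum_range_succ, Finset.sum_range_zero, coface_a₁]
  linear_combination gen Gen.a₁ * two_eq_zero

theorem delta_s : delta 1 (gen (Gen.s 0)) = 0 := by
  simp only [delta, Finset.sum_range_succ, Finset.sum_range_zero, coface_s, faceS]
  norm_num
  linear_combination (gen (Gen.s 0) + gen (Gen.s 1)) * two_eq_zero

theorem coface_r (j : ℕ) : coface j (rr (gen Gen.a₁) (gen (Gen.s 0))) =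
    rr (gen Gen.a₁) (faceS j 0) := by rw [coface_rr, coface_a₁, coface_s]

theorem delta_r : delta 1 (rr (gen Gen.a₁) (gen (Gen.s 0))) = 0 := by
  simp only [delta, Finset.sum_range_succ, Finset.sum_range_zero, coface_r, faceS]
  norm_num
  rw [rr_add]
  linear_combination (rr (gen Gen.a₁) (gen (Gen.s 0)) + rr (gen Gen.a₁) (gen (Gen.s 1))) *
    two_eq_zero

/-- The cochain `[a₃ s + a₁ t']`, where `t' = t + s r` (so `d [t'] = [r | s]`). -/
def xCochain : Str :=
  gen Gen.a₃ * gen (Gen.s 0) +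
    gen Gen.a₁ * (gen (Gen.t 0) + gen (Gen.s 0) * rr (gen Gen.a₁) (gen (Gen.s 0)))

theorem xCochain_eq : xCochain = rr (gen Gen.a₁) (gen (Gen.s 0)) ^ 2 := by
  have h := gen_string.1
  simp only [xCochain, rr, rel₁] at *
  linear_combination -h +
    (gen Gen.a₃ * gen (Gen.s 0) + gen Gen.a₁ * gen (Gen.t 0)) * two_eq_zero

theorem xCochain_mem : xCochain ∈ cochains 1 := by
  rw [xCochain_eq]
  exact pow_mem (rr_mem (a₁_mem 1) (s_mem one_pos)) 2

theorem delta_xCochain : delta 1 xCochain = 0 := by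
  rw [xCochain_eq]
  simp only [delta, Finset.sum_range_succ, Finset.sum_range_zero, map_pow, coface_r, faceS]
  norm_num
  rw [rr_add]
  linear_combination (rr (gen Gen.a₁) (gen (Gen.s 0)) ^ 2 + rr (gen Gen.a₁) (gen (Gen.s 1)) ^ 2
    + rr (gen Gen.a₁) (gen (Gen.s 0)) * rr (gen Gen.a₁) (gen (Gen.s 1))) * two_eq_zero

/-- The discriminant of `y² + a₁ x y + a₃ y = x³` modulo `2`. -/
def discr : Str := gen Gen.a₃ ^ 4 + gen Gen.a₁ ^ 3 * gen Gen.a₃ ^ 3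

theorem discr_mem : discr ∈ cochains 0 :=
  add_mem (pow_mem (a₃_mem 0) 4) (mul_mem (pow_mem (a₁_mem 0) 3) (pow_mem (a₃_mem 0) 3))

theorem discr_invariant (a c s t : Str) (h : rel₁ a c s t = 0) (h₂ : rel₂ a c s t = 0) :
    (c + a * rr a s) ^ 4 + a ^ 3 * (c + a * rr a s) ^ 3 = c ^ 4 + a ^ 3 * c ^ 3 := by
  have h' := h
  simp only [rel₁, rel₂, rr] at *
  linear_combination
    a ^ 4 * (s ^ 4 + a * s ^ 3 + a * t + c * s + a * c + a ^ 2 * (s ^ 2 + a * s)) * h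
      + a ^ 6 * h₂ +
      (2*a*c^3*s^2 + 2*a^2*c^3*s + 3*a^2*c^2*s^4 + 6*a^3*c^2*s^3 + 4*a^4*c^2*s^2 + 2*a^3*c*s^6
        + 5*a^4*c*s^5 + 6*a^5*c*s^4 + 4*a^6*c*s^3 + a^5*s^7 + 2*a^6*s^6 + 2*a^7*s^5 + a^8*s^4 +
        a^5*c^2*s + a^7*c*s^2 + (-1)*a^5*s^4*t + (-1)*a^6*s^3*t + (-1)*a^6*t^2 + (-1)*a^5*c*s*t
        + (-1)*a^6*c*t + (-1)*a^7*s^2*t + (-1)*a^8*s*t) * two_eq_zero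

theorem delta_discr : delta 0 discr = 0 := by
  have h := discr_invariant _ _ _ _ gen_string.1 gen_string.2
  simp only [delta, Finset.sum_range_succ, Finset.sum_range_zero, discr, map_add, map_mul,
    map_pow, coface_a₁, coface_a₃, faceA, st, stage]
  norm_num
  rw [h]
  linear_combination (gen Gen.a₃ ^ 4 + gen Gen.a₁ ^ 3 * gen Gen.a₃ ^ 3) * two_eq_zero

namespace Coh

/-- `a₁ ∈ H^{0,2}`. -/
def a₁ : H := cls (mk 0 (gen Gen.a₁) (a₁_mem 0)) (diff_mk_eq_zero _ delta_a₁)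

/-- `h₁ = [s] ∈ H^{1,2}`. -/
def h₁ : H := cls (mk 1 (gen (Gen.s 0)) (s_mem one_pos)) (diff_mk_eq_zero _ delta_s)

/-- `h₂ = [r] = [s² + a₁ s] ∈ H^{1,4}`. -/
def h₂ : H :=
  cls (mk 1 (rr (gen Gen.a₁) (gen (Gen.s 0))) (rr_mem (a₁_mem 1) (s_mem one_pos)))
    (diff_mk_eq_zero _ delta_r)

/-- `x = [a₃ s + a₁ t'] ∈ H^{1,8}`, an element of `⟨a₁, h₂, h₁⟩`. -/
def x : H := cls (mk 1 xCochain xCochain_mem) (diff_mk_eq_zero _ delta_xCochain)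

/-- `d = x² ∈ H^{2,16}`. -/
def d : H := x ^ 2

/-- `Δ ∈ H^{0,24}`. -/
def Δ : H := cls (mk 0 discr discr_mem) (diff_mk_eq_zero _ delta_discr)

/-- `g` is a class in `H^{4,24}` that restricts to the polynomial generator of
`H^{*,*}(A₂, Γ₂)`, `(A₂, Γ₂) = (A₀, Γ₀) / (a₁, a₃)`, that is represented by `[t | t | t | t]`
plus terms of higher filtration for the ideal `(s²)`: some cocycle in `g` is congruent to
`[t | t | t | t]` modulo `a₁`, `a₃` and the squares of the elements `s` of the four factors. -/
def IsLiftOfGenerator (g : H) : Prop :=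
  ∃ (f : Str) (hf : f ∈ cochains 4) (hz : diff (mk 4 f hf) = 0),
    f ∈ internal 24 ∧ cls (mk 4 f hf) hz = g ∧
    f - gen (Gen.t 0) * gen (Gen.t 1) * gen (Gen.t 2) * gen (Gen.t 3) ∈
      Ideal.span ({gen Gen.a₁, gen Gen.a₃} ∪ {e | ∃ i < 4, e = gen (Gen.s i) ^ 2})

end Coh

end EllCobar

end

open EllCobar

/-!
The extensions are proved on the level of cobar cochains.

The cobar complex in internal coordinates. `Γ₀` is free over `A₀` of rank eight, and the normalized
cobar complex has as basis over `𝔽₂[a₁]` the words in the letters `s`, `r = s² + a₁ s`, `t`,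
`y = s r`, `m = s t + a₁ t`, `n = r t`, `μ = r m` followed by a power of `a₃`. Moving `a₃` to the
right through a letter and the differentials of the letters are given by short formulas, which are
the fields of `CobarLetters`. Every identity between cochains is therefore checked by expanding both
sides into words, in any differential graded ring with such letters; `EllCobar.letters` shows that
the cobar complex is one.

The extensions. The cocycle `X = r²` represents `x`. Squaring `d t' = r s` in `Γ₀` gives a cochain
`t'²` with `d (t'²) = X (r + a₁ s)`, which is the first extension (`CobarLetters.X_mul_r`), and the
second follows from it. As `d (a₃²) = a₁² X` and `d (a₁ a₃) = a₁² r`, the cocycle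
`yRep = a₃² r + X a₁ a₃` represents an element of `⟨x, a₁², h₂⟩`, and `a₃² t'` bounds
`yRep s + a₁ X X` (`CobarLetters.yRep_mul_s`).

Uniqueness of `⟨x, a₁², h₂⟩`. All choices are made among cochains of cohomological degree zero and
internal degree at most twelve, that is, among the finitely many combinations of monomials in `a₁`
and `a₃` of that degree. A point of the groupoid over the field with sixteen elements shows that
`a₁⁴ r` and `a₁² X` are linearly independent (`EllCobar.smul_r_add_smul_X`), so the equations for
the null-homotopies leave free only the coefficient of `a₁² r` in the representative of `x` and
those of powers of `a₁`; these do not affect the class (`CobarLetters.massey_x_a_sq_r`).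

The class `g`. There are explicit null-homotopies `u` of `s s X X` and `v` of `s X X X`, and the
cocycle `u X + s v` is `a₁² g` plus a coboundary, where `g` is an explicit cocycle with leading term
`t t t t` (`CobarLetters.u_mul_X_add_s_mul_v_eq`). This is the statement `g a₁² ∈ ⟨h₁, d h₁, x⟩`.
Multiplying by `a₁²` and using `a₁² X = d (a₃²)` turns `u X + s v` into `Δ s s s s` up to a
coboundary (`CobarLetters.a_pow_four_mul_g`). That `g` is of bidegree `(4, 24)` and has the leading
term `t t t t` is read off from its formula, factor by factor (`CobarLetters.Grading`).
-/

-- The identities between words are all checked with one list of rewriting rules, and most of them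
-- do not use every rule.
set_option linter.unusedSimpArgs false

/-! ### Differential graded rings of characteristic two -/

namespace DGRing₂

variable {R : Type*} [Ring R] [DGRing₂ R]

theorem add_self_zero (z : R) : z + z = 0 := by
  rw [← two_mul, two_eq_zero, zero_mul]

theorem eq_of_add {x z : R} (h : x + z = 0) : x = z := by
  rw [← add_zero x, ← add_self_zero z, ← add_assoc, h, zero_add]

/-- The even coefficients that occur when identities between words are expanded. -/
theorem zsmul_of_even : (∀ z : R, (2 : ℤ) • z = 0) ∧ (∀ z : R, (4 : ℤ) • z = 0) ∧
    (∀ z : R, (6 : ℤ) • z = 0) ∧ (∀ z : R, (8 : ℤ) • z = 0) ∧ (∀ z : R, (10 : ℤ) • z = 0) ∧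
    (∀ z : R, (12 : ℤ) • z = 0) ∧ (∀ z : R, (14 : ℤ) • z = 0) := by
  have h : ∀ k : ℤ, Even k → ∀ z : R, k • z = 0 := by
    rintro _ ⟨k, rfl⟩ z
    rw [add_smul, add_self_zero]
  refine ⟨?_, ?_, ?_, ?_, ?_, ?_, ?_⟩ <;> exact h _ (by decide)

theorem sub_eq_add (z w : R) : z - w = z + w := by
  rw [sub_eq_add_neg, neg_eq_of_add_eq_zero_left (add_self_zero w)]

theorem diff_mul_eq_zero {a b : R} (ha : diff a = 0) (hb : diff b = 0) : diff (a * b) = 0 := by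
  rw [diff_mul, ha, hb, zero_mul, mul_zero, add_zero]

theorem cls_mul {a b : R} (ha : diff a = 0) (hb : diff b = 0) :
    cls a ha * cls b hb = cls (a * b) (diff_mul_eq_zero ha hb) := rfl

theorem cls_eq_iff {a b : R} (ha : diff a = 0) (hb : diff b = 0) :
    cls a ha = cls b hb ↔ ∃ w, diff w = a - b := by
  refine ((coboundaries R).ringCon.eq (a := ⟨a, ha⟩) (b := ⟨b, hb⟩)).trans ?_
  rw [TwoSidedIdeal.rel_iff]
  exact TwoSidedIdeal.mem_mk' _ _ _ _ _ _ _

theorem cls_eq {a b w : R} (ha : diff a = 0) (hb : diff b = 0) (h : a = b + diff w) :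
    cls a ha = cls b hb :=
  (cls_eq_iff ha hb).2 ⟨w, by rw [h, add_sub_cancel_left]⟩

theorem cls_congr {a b : R} (ha : diff a = 0) (hb : diff b = 0) (h : a = b) :
    cls a ha = cls b hb := by
  subst h; rfl

theorem exists_cls (ζ : Cohomology R) : ∃ (z : R) (hz : diff z = 0), cls z hz = ζ := by
  obtain ⟨⟨z, hz⟩, rfl⟩ := (coboundaries R).ringCon.mk'_surjective ζ
  exact ⟨z, hz, rfl⟩

theorem diff_pow_eq_zero {a : R} (ha : diff a = 0) (n : ℕ) : diff (a ^ n) = 0 :=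
  (cocycles R).pow_mem ha n

theorem cls_pow {a : R} (ha : diff a = 0) (n : ℕ) :
    cls a ha ^ n = cls (a ^ n) (diff_pow_eq_zero ha n) := rfl

end DGRing₂

open DGRing₂

/-! ### Calculus of words in the cobar complex -/

/-- Elements of a differential graded ring that satisfy the relations of the cobar cochains
`a = a₁`, `c = a₃` of degree zero and `s`, `r = s² + a₁ s`, `t`, `y = s r`, `m = s t + a₁ t`,
`n = r t`, `μ = r m` of degree one; products on the right of these equations are taken in `Γ₀`,
whereas the product of the differential ring is concatenation. The words in the seven letters of
degree one, followed by powers of `c`, form a basis of the normalized cobar complex over `𝔽₂[a]`,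
and the relations suffice to rewrite every expression in this basis. -/
structure CobarLetters (R : Type*) [Ring R] [DGRing₂ R] where
  (a c s r t y m n μ : R)
  mul_a : ∀ z, z * a = a * z
  c_s : c * s = s * c + a * y
  c_r : c * r = r * c + a * (s * c) + a * (a * t)
  c_t : c * t = t * c + a * n
  c_y : c * y = y * c + a * (r * c) + a * (a * (s * c)) + a * (a * (a * t)) + a * (a * m)
  c_m : c * m = m * c + a * μ
  c_n : c * n = n * c + a * (m * c) + a * (a * (y * c)) + a * (a * (a * n))
  c_μ : c * μ = μ * c + a * (n * c) + a * (a * (s * (c * c))) + a * (a * (m * c)) +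
    a * (a * (a * (t * c))) + a * (a * (a * μ))
  diff_a : diff a = 0
  diff_c : diff c = a * r
  diff_s : diff s = 0
  diff_r : diff r = 0
  diff_t : diff t = s * r
  diff_y : diff y = s * r + r * s
  diff_m : diff m = r * r + t * s + s * t + s * y
  diff_n : diff n = r * t + t * r + y * r + s * (s * c) + a * (s * t)
  diff_μ : diff μ = s * n + n * s + y * y + y * t + t * y + r * m + m * r + r * (s * c) +
    a * (s * m) + a * (r * t) + a * (t * r)

namespace CobarLetters
variable {R : Type*} [Ring R] [DGRing₂ R] (K : CobarLetters R)

theorem mul_a_mul (x z : R) : x * (K.a * z) = K.a * (x * z) := by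
  rw [← mul_assoc, K.mul_a, mul_assoc]

/-- Rewriting rules that move `c` to the right end of a word. -/
theorem reorder :
    (K.c * K.s = K.s * K.c + K.a * K.y) ∧
    (K.c * K.r = K.r * K.c + K.a * (K.s * K.c) + K.a * (K.a * K.t)) ∧
    (K.c * K.t = K.t * K.c + K.a * K.n) ∧
    (K.c * K.y = K.y * K.c + K.a * (K.r * K.c) + K.a * (K.a * (K.s * K.c)) +
      K.a * (K.a * (K.a * K.t)) + K.a * (K.a * K.m)) ∧
    (K.c * K.m = K.m * K.c + K.a * K.μ) ∧
    (K.c * K.n = K.n * K.c + K.a * (K.m * K.c) + K.a * (K.a * (K.y * K.c)) +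
      K.a * (K.a * (K.a * K.n))) ∧
    (K.c * K.μ = K.μ * K.c + K.a * (K.n * K.c) + K.a * (K.a * (K.s * (K.c * K.c))) +
      K.a * (K.a * (K.m * K.c)) + K.a * (K.a * (K.a * (K.t * K.c))) +
      K.a * (K.a * (K.a * K.μ))) ∧
    (∀ z, K.c * (K.s * z) = K.s * (K.c * z) + K.a * (K.y * z)) ∧
    (∀ z, K.c * (K.r * z) = K.r * (K.c * z) + K.a * (K.s * (K.c * z)) + K.a * (K.a * (K.t * z))) ∧
    (∀ z, K.c * (K.t * z) = K.t * (K.c * z) + K.a * (K.n * z)) ∧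
    (∀ z, K.c * (K.y * z) = K.y * (K.c * z) + K.a * (K.r * (K.c * z)) +
      K.a * (K.a * (K.s * (K.c * z))) + K.a * (K.a * (K.a * (K.t * z))) +
      K.a * (K.a * (K.m * z))) ∧
    (∀ z, K.c * (K.m * z) = K.m * (K.c * z) + K.a * (K.μ * z)) ∧
    (∀ z, K.c * (K.n * z) = K.n * (K.c * z) + K.a * (K.m * (K.c * z)) +
      K.a * (K.a * (K.y * (K.c * z))) + K.a * (K.a * (K.a * (K.n * z)))) ∧
    (∀ z, K.c * (K.μ * z) = K.μ * (K.c * z) + K.a * (K.n * (K.c * z)) +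
      K.a * (K.a * (K.s * (K.c * (K.c * z)))) + K.a * (K.a * (K.m * (K.c * z))) +
      K.a * (K.a * (K.a * (K.t * (K.c * z)))) + K.a * (K.a * (K.a * (K.μ * z)))) := by
  refine ⟨K.c_s, K.c_r, K.c_t, K.c_y, K.c_m, K.c_n, K.c_μ, ?_, ?_, ?_, ?_, ?_, ?_, ?_⟩ <;> intro z
  · rw [← mul_assoc, K.c_s]; simp only [add_mul, mul_assoc]
  · rw [← mul_assoc, K.c_r]; simp only [add_mul, mul_assoc]
  · rw [← mul_assoc, K.c_t]; simp only [add_mul, mul_assoc]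
  · rw [← mul_assoc, K.c_y]; simp only [add_mul, mul_assoc]
  · rw [← mul_assoc, K.c_m]; simp only [add_mul, mul_assoc]
  · rw [← mul_assoc, K.c_n]; simp only [add_mul, mul_assoc]
  · rw [← mul_assoc, K.c_μ]; simp only [add_mul, mul_assoc]

/-- Rewriting rules that move the central element `a` to the left end of a word. -/
theorem central :
    (K.s * K.a = K.a * K.s) ∧ (K.r * K.a = K.a * K.r) ∧ (K.t * K.a = K.a * K.t) ∧
    (K.y * K.a = K.a * K.y) ∧ (K.m * K.a = K.a * K.m) ∧ (K.n * K.a = K.a * K.n) ∧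
    (K.μ * K.a = K.a * K.μ) ∧ (K.c * K.a = K.a * K.c) ∧
    (∀ z, K.s * (K.a * z) = K.a * (K.s * z)) ∧ (∀ z, K.r * (K.a * z) = K.a * (K.r * z)) ∧
    (∀ z, K.t * (K.a * z) = K.a * (K.t * z)) ∧ (∀ z, K.y * (K.a * z) = K.a * (K.y * z)) ∧
    (∀ z, K.m * (K.a * z) = K.a * (K.m * z)) ∧ (∀ z, K.n * (K.a * z) = K.a * (K.n * z)) ∧
    (∀ z, K.μ * (K.a * z) = K.a * (K.μ * z)) ∧ (∀ z, K.c * (K.a * z) = K.a * (K.c * z)) :=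
  ⟨K.mul_a _, K.mul_a _, K.mul_a _, K.mul_a _, K.mul_a _, K.mul_a _, K.mul_a _, K.mul_a _,
    K.mul_a_mul _, K.mul_a_mul _, K.mul_a_mul _, K.mul_a_mul _, K.mul_a_mul _, K.mul_a_mul _,
    K.mul_a_mul _, K.mul_a_mul _⟩

theorem diff_letters :
    diff K.a = 0 ∧ diff K.c = K.a * K.r ∧ diff K.s = 0 ∧ diff K.r = 0 ∧ diff K.t = K.s * K.r ∧
    diff K.y = K.s * K.r + K.r * K.s ∧
    diff K.m = K.r * K.r + K.t * K.s + K.s * K.t + K.s * K.y ∧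
    diff K.n = K.r * K.t + K.t * K.r + K.y * K.r + K.s * (K.s * K.c) + K.a * (K.s * K.t) ∧
    diff K.μ = K.s * K.n + K.n * K.s + K.y * K.y + K.y * K.t + K.t * K.y + K.r * K.m +
      K.m * K.r + K.r * (K.s * K.c) + K.a * (K.s * K.m) + K.a * (K.r * K.t) +
      K.a * (K.t * K.r) :=
  ⟨K.diff_a, K.diff_c, K.diff_s, K.diff_r, K.diff_t, K.diff_y, K.diff_m, K.diff_n, K.diff_μ⟩

/-- The cocycle `r² = a₃ s + a₁ t'`, a representative of `x`. It equals both
`s · a₃ + a₁ t` and `a₃ · s + a₁ t'`, for the right and the left multiplication by `a₃`. -/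
def X : R :=
  K.s * K.c + K.a * K.t

/-- The element `t' = t + s r`, with `d t' = r s`. -/
def tbar : R :=
  K.t + K.y

/-- The element `r³` of `Γ₀`, so that `d (r³) = r X + X r`. -/
def ρ : R :=
  K.y * K.c + K.a * K.n

theorem diff_X : diff K.X = 0 := by
  simp only [X, K.diff_letters, K.reorder, K.central, diff_mul, map_add, mul_add, add_mul,
    mul_assoc, mul_zero, zero_mul, zero_add, add_zero]
  abel_nf
  simp only [@zsmul_of_even R _ _, zero_add, add_zero]

/-- The squares `t²` and `t'²` of `Γ₀` equal `t · a₃ + r³` and `a₃ · t' + r³`. Squaring the equation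
`d t' = r s` gives `d (t'²) = X (r + a₁ s)`, which is the extension `x h₂ = a₁ x h₁`. -/
theorem X_mul_r : K.X * K.r = K.a * K.X * K.s + diff (K.c * K.tbar + K.ρ) := by
  apply eq_of_add
  simp only [X, tbar, ρ, K.diff_letters, K.reorder, K.central, diff_mul, map_add, mul_add, add_mul,
    mul_assoc, mul_zero, zero_mul, zero_add, add_zero]
  abel_nf
  simp only [@zsmul_of_even R _ _, zero_add, add_zero]

/-- The product `s X = r · a₃ + a₁ X + a₁ m` of `Γ₀` shows that `h₁` and `x` commute. -/
theorem s_mul_X : K.s * K.X = K.X * K.s + diff (K.r * K.c + K.a * K.X + K.a * K.m) := by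
  apply eq_of_add
  simp only [X, K.diff_letters, K.reorder, K.central, diff_mul, map_add, mul_add, add_mul,
    mul_assoc, mul_zero, zero_mul, zero_add, add_zero]
  abel_nf
  simp only [@zsmul_of_even R _ _, zero_add, add_zero]

theorem diff_c_sq : diff (K.c * K.c) = K.a * K.a * K.X := by
  apply eq_of_add
  simp only [X, K.diff_letters, K.reorder, K.central, diff_mul, map_add, mul_add, add_mul,
    mul_assoc, mul_zero, zero_mul, zero_add, add_zero]
  abel_nf
  simp only [@zsmul_of_even R _ _, zero_add, add_zero]

/-- The cocycle `r⁴ = X²` of `Γ₀`, in the form that represents the Massey product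
`⟨x, a₁², h₂⟩` for the null-homotopies `d (a₃²) = a₁² X` and `d (a₁ a₃) = a₁² r`. -/
def yRep : R :=
  K.c * K.c * K.r + K.X * (K.a * K.c)

theorem diff_yRep : diff K.yRep = 0 := by
  simp only [yRep, X, K.diff_letters, K.reorder, K.central, diff_mul, map_add, mul_add, add_mul,
    mul_assoc, mul_zero, zero_mul, zero_add, add_zero]
  abel_nf
  simp only [@zsmul_of_even R _ _, zero_add, add_zero]

theorem yRep_mul_s : K.yRep * K.s = K.a * K.X * K.X + diff (K.c * K.c * K.tbar) := by
  apply eq_of_add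
  simp only [yRep, X, tbar, K.diff_letters, K.reorder, K.central, diff_mul, map_add, mul_add,
    add_mul, mul_assoc, mul_zero, zero_mul, zero_add, add_zero]
  abel_nf
  simp only [@zsmul_of_even R _ _, zero_add, add_zero]

theorem diff_a_mul_c : diff (K.a * K.c) = K.a * (K.a * K.r) := by
  rw [diff_mul, K.diff_a, K.diff_c, zero_mul, zero_add]

/-- The choices in the Massey product `⟨x, a₁², h₂⟩` are the coefficient `e` of `a₁² r` in the
representative of `x`, which is also that of `a₁³ a₃` in the null-homotopy of `a₁² x`, and the
coefficients `k`, `l` of the cocycles `a₁⁶`, `a₁⁴`. None of them affects the class. -/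
theorem massey_x_a_sq_r {e k l : R} (he : e = 0 ∨ e = 1) (hk : k = 0 ∨ k = 1)
    (hl : l = 0 ∨ l = 1) :
    (k * (K.a * (K.a * (K.a * (K.a * (K.a * K.a))))) + e * (K.a * (K.a * (K.a * K.c))) +
        K.c * K.c) * K.r +
      (K.X + e * (K.a * (K.a * K.r))) * (l * (K.a * (K.a * (K.a * K.a))) + K.a * K.c) =
    K.yRep + diff (e * (K.a * (K.a * (K.c * K.c))) +
      k * (K.a * (K.a * (K.a * (K.a * (K.a * K.c))))) +
      l * (K.a * (K.a * (K.c * K.c)) + e * (K.a * (K.a * (K.a * (K.a * (K.a * K.c))))))) := by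
  apply eq_of_add
  rcases he with rfl | rfl <;> rcases hk with rfl | rfl <;> rcases hl with rfl | rfl <;>
  · simp only [yRep, X, K.diff_letters, K.reorder, K.central, diff_mul, map_add, map_zero, mul_add,
      add_mul, mul_assoc, mul_zero, zero_mul, one_mul, zero_add, add_zero]
    abel_nf
    simp only [@zsmul_of_even R _ _, zero_add, add_zero]

/-- The discriminant. -/
def disc : R :=
  K.c * K.c * K.c * K.c + K.a * K.a * K.a * K.c * K.c * K.c

theorem disc_mul_s : K.disc * K.s = K.s * K.disc := by
  apply eq_of_add
  simp only [disc, K.diff_letters, K.reorder, K.central, diff_mul, map_add, mul_add, add_mul,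
    mul_assoc, mul_zero, zero_mul, zero_add, add_zero]
  abel_nf
  simp only [@zsmul_of_even R _ _, zero_add, add_zero]

/-- A null-homotopy of `r r r + s s X`; its leading term is `t t`. -/
def W : R :=
  K.m * K.r + K.t * K.t + K.s * K.n

/-- A null-homotopy of `s s X X`: the equations `s s X = r r r + d W`, `r X = a₁ s X + d (t²)` and
`r s = d t'` are applied in turn. -/
def u : R :=
  K.W * K.X + K.r * K.r * (K.t * K.c + K.ρ) + K.a * K.r * K.tbar * K.X

theorem diff_u : diff K.u = K.s * K.s * K.X * K.X := by
  apply eq_of_add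
  simp only [u, W, X, tbar, ρ, K.diff_letters, K.reorder, K.central, diff_mul, map_add, mul_add,
    add_mul, mul_assoc, mul_zero, zero_mul, zero_add, add_zero]
  abel_nf
  simp only [@zsmul_of_even R _ _, zero_add, add_zero]

/-- A null-homotopy of `s X X X`. It is the quotient by `a₁²` of `s s s Δ + s X X c c`, up to a
coboundary: replace `s c` by `X + a t` repeatedly and use
`t X + s t² = r r c + a W + d (m c)`. -/
def v : R :=
  K.t * K.r * (K.r * K.c * K.c + K.a * K.X * K.c + K.a * K.a * K.ρ) + K.s * K.W * K.c * K.c +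
    K.a * K.s * K.s * K.s * K.c * K.c * K.c + K.a * K.s * K.m * K.c * K.X

set_option maxHeartbeats 4000000 in
theorem diff_v : diff K.v = K.s * K.X * K.X * K.X := by
  apply eq_of_add
  simp only [v, W, X, ρ, K.diff_letters, K.reorder, K.central, diff_mul, map_add, mul_add, add_mul,
    mul_assoc, mul_zero, zero_mul, zero_add, add_zero]
  abel_nf
  simp only [@zsmul_of_even R _ _, zero_add, add_zero]

theorem a_sq_mul_v : K.a * K.a * K.v = K.s * K.s * K.s * K.disc + K.s * K.X * K.X * (K.c * K.c) +
    diff (K.a * (K.s * K.m * K.c * K.c * K.c + K.t * K.r * K.c * K.c * K.c)) := by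
  apply eq_of_add
  simp only [disc, v, W, X, ρ, K.diff_letters, K.reorder, K.central, diff_mul, map_add, mul_add,
    add_mul, mul_assoc, mul_zero, zero_mul, zero_add, add_zero]
  abel_nf
  simp only [@zsmul_of_even R _ _, zero_add, add_zero]

/-- A cochain that shows that `s` and `W` commute up to decomposable terms:
`s W + W s = r r t' + t r r + s s (r c + a X + a m) + d lam`. -/
def lam : R :=
  K.m * K.tbar + K.t * K.m + K.s * (K.μ + K.ρ)

/-- A cochain that, with `F`, compares `r` and `W` under concatenation:
`W r + r W = s s c t + t' s s c + a F + d V`. -/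
def V : R :=
  K.tbar * K.n + K.n * K.t + K.μ * K.r + K.r * K.c * K.t

/-- The remainder divisible by `a` in the comparison of `W r` with `r W`. -/
def F : R :=
  K.s * K.m * K.r + K.s * K.t * K.t + K.tbar * K.s * K.t + K.r * K.r * K.t + K.r * K.tbar * K.r +
    K.t * K.r * K.r

/-- The leading part of `g`. It arises from `u X + s v` on substituting
`X X = s s c c + a (r r c + a W + d (m c))` in `W X X` and commuting `W` with `s s`. -/
def gLead : R :=
  K.W * K.W + (K.lam * K.s + K.s * K.lam + K.t * K.r * K.tbar) * K.X + K.s * K.s * K.t * K.X * K.c +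
    K.a * K.s * K.s * K.t * K.ρ + K.s * K.s * K.c * K.tbar * K.X + K.s * K.t * K.r * K.ρ

/-- The cochain whose coboundary accompanies `gLead`. -/
def zLead : R :=
  (K.lam * K.s + K.s * K.lam + K.t * K.r * K.tbar) * K.c * K.c + K.a * K.W * K.m * K.c +
    K.s * K.s * K.c * K.tbar * K.c * K.c + K.s * K.s * K.t * K.c * K.c * K.c

/-- What remains of `u X + s v` after removing `a² gLead` and a coboundary, divided by `a`. -/
def residue : R :=
  K.r * K.r * (K.tbar * K.t * K.c + K.tbar * K.ρ + K.n * K.X) + K.W * K.r * K.r * K.c +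
    K.r * K.r * K.r * K.m * K.c +
    K.s * K.s * (K.r * K.tbar + K.t * K.r + K.m * K.s + K.s * K.X + K.s * K.m) * K.c * K.c +
      K.s * K.s * K.s * K.s * K.c * K.c * K.c +
    K.s * K.s * (K.X * K.m * K.c + K.m * K.c * K.X) + K.s * K.t * K.r * K.X * K.c +
      K.r * K.tbar * K.X * K.X

/-- The cochain whose coboundary accompanies `gCorr`. -/
def zCorr : R :=
  (K.r * K.r * K.μ + K.V * K.r + K.r * K.V) * K.c +
    (K.tbar * K.s * K.t + K.r * K.r * K.tbar + K.s * K.t * K.tbar) * K.c * K.c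

/-- The quotient of `residue` by `a`, up to a coboundary, obtained by commuting `W` with `r r`. -/
def gCorr : R :=
  K.s * K.s * (K.s * K.t * K.c * K.c + K.m * K.t * K.c + K.m * K.ρ + K.t * K.m * K.c +
    K.s * K.μ * K.c + K.t * K.X * K.c + K.n * K.r * K.c) +
    K.s * K.t * K.r * K.t * K.c + K.r * K.tbar * (K.t * K.s + K.s * K.tbar) * K.c +
      K.a * K.r * K.tbar * (K.t * K.t + K.s * K.n) +
    K.r * K.r * (K.tbar * K.n + K.n * K.t + K.μ * K.r) + K.r * K.r * (K.r * K.t + K.s * K.m +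
      K.t * K.r) * K.c + (K.V * K.r + K.r * K.V) * K.r +
    (K.tbar * K.s * K.s * K.X + K.r * K.s * K.s * K.n + K.F * K.r + K.r * K.F) * K.c +
    K.a * (K.tbar * K.s * K.t + K.r * K.r * K.tbar + K.s * K.t * K.tbar) * K.X

/-- A cocycle with leading term `t t t t`. -/
def g : R :=
  K.gLead + K.gCorr

set_option maxHeartbeats 4000000 in
theorem u_mul_X_add_s_mul_v : K.u * K.X + K.s * K.v + diff K.zLead =
    K.a * K.a * K.gLead + K.a * K.residue := by
  apply eq_of_add
  simp only [u, v, W, X, ρ, tbar, lam, gLead, zLead, residue, K.diff_letters, K.reorder, K.central,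
    diff_mul, map_add, mul_add, add_mul, mul_assoc, mul_zero, zero_mul, zero_add, add_zero]
  abel_nf
  simp only [@zsmul_of_even R _ _, zero_add, add_zero]

set_option maxHeartbeats 4000000 in
theorem residue_eq : K.residue = diff K.zCorr + K.a * K.gCorr := by
  apply eq_of_add
  simp only [V, F, W, X, ρ, tbar, gCorr, zCorr, residue, K.diff_letters, K.reorder, K.central,
    diff_mul, map_add, mul_add, add_mul, mul_assoc, mul_zero, zero_mul, zero_add, add_zero]
  abel_nf
  simp only [@zsmul_of_even R _ _, zero_add, add_zero]

set_option maxHeartbeats 4000000 in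
set_option maxRecDepth 10000 in
theorem diff_g : diff K.g = 0 := by
  simp only [g, gLead, gCorr, V, F, W, X, ρ, tbar, lam, K.diff_letters, K.reorder, K.central,
    diff_mul, map_add, mul_add, add_mul, mul_assoc, mul_zero, zero_mul, zero_add, add_zero]
  abel_nf
  simp only [@zsmul_of_even R _ _, zero_add, add_zero]

/-- The relation `a₁² g ∈ ⟨h₁, d h₁, x⟩` for the null-homotopies `u` and `v`. -/
theorem u_mul_X_add_s_mul_v_eq :
    K.u * K.X + K.s * K.v = K.a * K.a * K.g + diff (K.zLead + K.a * K.zCorr) := by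
  have h : K.u * K.X + K.s * K.v =
      K.a * K.a * K.gLead + K.a * K.residue + diff K.zLead := by
    rw [← K.u_mul_X_add_s_mul_v, add_assoc, add_self_zero, add_zero]
  rw [h, K.residue_eq, map_add, diff_mul, K.diff_a, g]
  simp only [mul_add, zero_mul, zero_add, mul_assoc]
  abel

/-- The relation `a₁⁴ g = Δ h₁⁴`: multiply the previous one by `a₁²` and use that `a₁² v` and
`s s s Δ` differ by `s X X c c`, up to a coboundary, while `d (c c) = a₁² X`. -/
theorem a_pow_four_mul_g : K.a ^ 4 * K.g = K.disc * K.s ^ 4 +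
    diff (K.a * K.a * (K.zLead + K.a * K.zCorr) + K.u * (K.c * K.c) +
      K.s * (K.a * (K.s * K.m * K.c * K.c * K.c + K.t * K.r * K.c * K.c * K.c))) := by
  generalize hz : K.zLead + K.a * K.zCorr = z
  generalize hq : K.a * (K.s * K.m * K.c * K.c * K.c + K.t * K.r * K.c * K.c * K.c) = q
  have hM := K.u_mul_X_add_s_mul_v_eq
  have hv : K.s * (K.a * K.a * K.v) =
      K.disc * K.s ^ 4 + K.s * K.s * K.X * K.X * (K.c * K.c) + K.s * diff q := by
    have hs : Commute K.disc K.s := K.disc_mul_s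
    rw [K.a_sq_mul_v, hq, mul_add, mul_add, (hs.pow_right 4).eq]
    simp only [pow_succ, pow_zero, one_mul, mul_assoc]
  have hg : K.a ^ 4 * K.g =
      K.u * (K.a * K.a * K.X) + K.s * (K.a * K.a * K.v) + K.a * K.a * diff z := by
    have h : K.a * K.a * (K.u * K.X + K.s * K.v) =
        K.u * (K.a * K.a * K.X) + K.s * (K.a * K.a * K.v) := by
      simp only [mul_add, mul_assoc, K.mul_a_mul]
    rw [← h, hM, hz, mul_add, add_assoc, add_self_zero, add_zero]
    simp only [pow_succ, pow_zero, one_mul, mul_assoc]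
  rw [hg, hv, map_add, map_add, diff_mul (K.a * K.a), diff_mul K.u, diff_mul K.s, K.diff_u,
    K.diff_c_sq, diff_mul K.a, K.diff_a, K.diff_s]
  simp only [zero_mul, mul_zero, zero_add, add_zero]
  abel

end CobarLetters

/-! ### Bidegrees and leading terms -/

namespace CobarLetters

variable {R : Type*} [Ring R] [DGRing₂ R]

/-- Sets `B n m` of elements of bidegree `(n, m)` and sets `F n` of elements of cohomological degree
`n` and positive filtration, compatible with sums and products, for which the letters have the
bidegrees and filtrations that they have in the cobar complex. -/
structure Grading (K : CobarLetters R) where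
  B : ℕ → ℕ → Set R
  F : ℕ → Set R
  mul {n m p q z w} : z ∈ B n m → w ∈ B p q → z * w ∈ B (n + p) (m + q)
  add {n m z w} : z ∈ B n m → w ∈ B n m → z + w ∈ B n m
  mul_left {n m q z w} : z ∈ B n m → w ∈ F q → z * w ∈ F (n + q)
  mul_right {n m q z w} : z ∈ F q → w ∈ B n m → z * w ∈ F (q + n)
  addF {n z w} : z ∈ F n → w ∈ F n → z + w ∈ F n
  a_mem : K.a ∈ B 0 2
  c_mem : K.c ∈ B 0 6
  s_mem : K.s ∈ B 1 2
  r_mem : K.r ∈ B 1 4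
  t_mem : K.t ∈ B 1 6
  y_mem : K.y ∈ B 1 6
  m_mem : K.m ∈ B 1 8
  n_mem : K.n ∈ B 1 10
  μ_mem : K.μ ∈ B 1 12
  a_filt : K.a ∈ F 0
  c_filt : K.c ∈ F 0
  r_filt : K.r ∈ F 1
  n_filt : K.n ∈ F 1

namespace Grading

variable {K : CobarLetters R} (G : K.Grading)

theorem add_of_eq {n m p q : ℕ} {z w : R} (hz : z ∈ G.B n m) (hw : w ∈ G.B p q)
    (hn : p = n := by rfl) (hm : q = m := by rfl) : z + w ∈ G.B n m := by
  subst hn hm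
  exact G.add hz hw

theorem addF_of_eq {n p : ℕ} {z w : R} (hz : z ∈ G.F n) (hw : w ∈ G.F p)
    (hn : p = n := by rfl) : z + w ∈ G.F n := by
  subst hn
  exact G.addF hz hw

-- Proofs of membership are written like the elements themselves: `⬝` and `⊹` are the product and
-- sum of two homogeneous elements, `◃`, `▹` the products in which the right, respectively the left,
-- factor is of positive filtration, and `∔` the sum of two elements of positive filtration.
local infixl:70 " ⬝ " => Grading.mul _
local infixl:65 " ⊹ " => Grading.add_of_eq _
local infixl:70 " ◃ " => Grading.mul_left _
local infixl:70 " ▹ " => Grading.mul_right _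
local infixl:65 " ∔ " => Grading.addF_of_eq _

theorem X_mem : K.X ∈ G.B 1 8 :=
  (G.s_mem ⬝ G.c_mem ⊹ G.a_mem ⬝ G.t_mem :)
theorem tbar_mem : K.tbar ∈ G.B 1 6 :=
  (G.t_mem ⊹ G.y_mem :)
theorem ρ_mem : K.ρ ∈ G.B 1 12 :=
  (G.y_mem ⬝ G.c_mem ⊹ G.a_mem ⬝ G.n_mem :)
theorem W_mem : K.W ∈ G.B 2 12 :=
  (G.m_mem ⬝ G.r_mem ⊹ G.t_mem ⬝ G.t_mem ⊹ G.s_mem ⬝ G.n_mem :)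

theorem u_mem : K.u ∈ G.B 3 20 :=
  (G.W_mem ⬝ G.X_mem ⊹ G.r_mem ⬝ G.r_mem ⬝ (G.t_mem ⬝ G.c_mem ⊹ G.ρ_mem) ⊹
    G.a_mem ⬝ G.r_mem ⬝ G.tbar_mem ⬝ G.X_mem :)

theorem v_mem : K.v ∈ G.B 3 26 :=
  (G.t_mem ⬝ G.r_mem ⬝ (G.r_mem ⬝ G.c_mem ⬝ G.c_mem ⊹ G.a_mem ⬝ G.X_mem ⬝ G.c_mem ⊹
    G.a_mem ⬝ G.a_mem ⬝ G.ρ_mem) ⊹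
    G.s_mem ⬝ G.W_mem ⬝ G.c_mem ⬝ G.c_mem ⊹
      G.a_mem ⬝ G.s_mem ⬝ G.s_mem ⬝ G.s_mem ⬝ G.c_mem ⬝ G.c_mem ⬝ G.c_mem ⊹
    G.a_mem ⬝ G.s_mem ⬝ G.m_mem ⬝ G.c_mem ⬝ G.X_mem :)

theorem lam_mem : K.lam ∈ G.B 2 14 :=
  (G.m_mem ⬝ G.tbar_mem ⊹ G.t_mem ⬝ G.m_mem ⊹ G.s_mem ⬝ (G.μ_mem ⊹ G.ρ_mem) :)

theorem V_mem : K.V ∈ G.B 2 16 :=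
  (G.tbar_mem ⬝ G.n_mem ⊹ G.n_mem ⬝ G.t_mem ⊹ G.μ_mem ⬝ G.r_mem ⊹ G.r_mem ⬝ G.c_mem ⬝ G.t_mem :)

theorem F_mem : K.F ∈ G.B 3 14 :=
  (G.s_mem ⬝ G.m_mem ⬝ G.r_mem ⊹ G.s_mem ⬝ G.t_mem ⬝ G.t_mem ⊹ G.tbar_mem ⬝ G.s_mem ⬝ G.t_mem ⊹
    G.r_mem ⬝ G.r_mem ⬝ G.t_mem ⊹
    G.r_mem ⬝ G.tbar_mem ⬝ G.r_mem ⊹ G.t_mem ⬝ G.r_mem ⬝ G.r_mem :)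

theorem gLead_mem : K.gLead ∈ G.B 4 24 :=
  (G.W_mem ⬝ G.W_mem ⊹ (G.lam_mem ⬝ G.s_mem ⊹ G.s_mem ⬝ G.lam_mem ⊹
    G.t_mem ⬝ G.r_mem ⬝ G.tbar_mem) ⬝ G.X_mem ⊹
    G.s_mem ⬝ G.s_mem ⬝ G.t_mem ⬝ G.X_mem ⬝ G.c_mem ⊹
      G.a_mem ⬝ G.s_mem ⬝ G.s_mem ⬝ G.t_mem ⬝ G.ρ_mem ⊹
    G.s_mem ⬝ G.s_mem ⬝ G.c_mem ⬝ G.tbar_mem ⬝ G.X_mem ⊹ G.s_mem ⬝ G.t_mem ⬝ G.r_mem ⬝ G.ρ_mem :)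

theorem gCorr_mem : K.gCorr ∈ G.B 4 24 :=
  (G.s_mem ⬝ G.s_mem ⬝ (G.s_mem ⬝ G.t_mem ⬝ G.c_mem ⬝ G.c_mem ⊹ G.m_mem ⬝ G.t_mem ⬝ G.c_mem ⊹
    G.m_mem ⬝ G.ρ_mem ⊹
      G.t_mem ⬝ G.m_mem ⬝ G.c_mem ⊹ G.s_mem ⬝ G.μ_mem ⬝ G.c_mem ⊹ G.t_mem ⬝ G.X_mem ⬝ G.c_mem ⊹
      G.n_mem ⬝ G.r_mem ⬝ G.c_mem) ⊹
    G.s_mem ⬝ G.t_mem ⬝ G.r_mem ⬝ G.t_mem ⬝ G.c_mem ⊹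
    G.r_mem ⬝ G.tbar_mem ⬝ (G.t_mem ⬝ G.s_mem ⊹ G.s_mem ⬝ G.tbar_mem) ⬝ G.c_mem ⊹
    G.a_mem ⬝ G.r_mem ⬝ G.tbar_mem ⬝ (G.t_mem ⬝ G.t_mem ⊹ G.s_mem ⬝ G.n_mem) ⊹
    G.r_mem ⬝ G.r_mem ⬝ (G.tbar_mem ⬝ G.n_mem ⊹ G.n_mem ⬝ G.t_mem ⊹ G.μ_mem ⬝ G.r_mem) ⊹
    G.r_mem ⬝ G.r_mem ⬝ (G.r_mem ⬝ G.t_mem ⊹ G.s_mem ⬝ G.m_mem ⊹ G.t_mem ⬝ G.r_mem) ⬝ G.c_mem ⊹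
    (G.V_mem ⬝ G.r_mem ⊹ G.r_mem ⬝ G.V_mem) ⬝ G.r_mem ⊹
    (G.tbar_mem ⬝ G.s_mem ⬝ G.s_mem ⬝ G.X_mem ⊹ G.r_mem ⬝ G.s_mem ⬝ G.s_mem ⬝ G.n_mem ⊹
      G.F_mem ⬝ G.r_mem ⊹ G.r_mem ⬝ G.F_mem) ⬝ G.c_mem ⊹
    G.a_mem ⬝ (G.tbar_mem ⬝ G.s_mem ⬝ G.t_mem ⊹ G.r_mem ⬝ G.r_mem ⬝ G.tbar_mem ⊹
      G.s_mem ⬝ G.t_mem ⬝ G.tbar_mem) ⬝ G.X_mem :)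

theorem g_mem : K.g ∈ G.B 4 24 :=
  (G.gLead_mem ⊹ G.gCorr_mem :)

theorem X_filt : K.X ∈ G.F 1 := (G.s_mem ◃ G.c_filt ∔ G.a_filt ▹ G.t_mem :)
theorem ρ_filt : K.ρ ∈ G.F 1 := (G.y_mem ◃ G.c_filt ∔ G.a_filt ▹ G.n_mem :)

theorem gCorr_filt : K.gCorr ∈ G.F 4 :=
  (G.s_mem ⬝ G.s_mem ◃ (G.s_mem ⬝ G.t_mem ⬝ G.c_mem ◃ G.c_filt ∔ G.m_mem ⬝ G.t_mem ◃ G.c_filt ∔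
    G.m_mem ◃ G.ρ_filt ∔
      G.t_mem ⬝ G.m_mem ◃ G.c_filt ∔ G.s_mem ⬝ G.μ_mem ◃ G.c_filt ∔ G.t_mem ⬝ G.X_mem ◃ G.c_filt ∔
      G.n_mem ⬝ G.r_mem ◃ G.c_filt) ∔
    G.s_mem ⬝ G.t_mem ⬝ G.r_mem ⬝ G.t_mem ◃ G.c_filt ∔
    G.r_mem ⬝ G.tbar_mem ⬝ (G.t_mem ⬝ G.s_mem ⊹ G.s_mem ⬝ G.tbar_mem) ◃ G.c_filt ∔
    G.a_filt ▹ G.r_mem ▹ G.tbar_mem ▹ (G.t_mem ⬝ G.t_mem ⊹ G.s_mem ⬝ G.n_mem) ∔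
    G.r_filt ▹ G.r_mem ▹ (G.tbar_mem ⬝ G.n_mem ⊹ G.n_mem ⬝ G.t_mem ⊹ G.μ_mem ⬝ G.r_mem) ∔
    G.r_mem ⬝ G.r_mem ⬝ (G.r_mem ⬝ G.t_mem ⊹ G.s_mem ⬝ G.m_mem ⊹ G.t_mem ⬝ G.r_mem) ◃ G.c_filt ∔
    (G.V_mem ⬝ G.r_mem ⊹ G.r_mem ⬝ G.V_mem) ◃ G.r_filt ∔
    (G.tbar_mem ⬝ G.s_mem ⬝ G.s_mem ⬝ G.X_mem ⊹ G.r_mem ⬝ G.s_mem ⬝ G.s_mem ⬝ G.n_mem ⊹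
      G.F_mem ⬝ G.r_mem ⊹ G.r_mem ⬝ G.F_mem) ◃
      G.c_filt ∔
    G.a_mem ⬝ (G.tbar_mem ⬝ G.s_mem ⬝ G.t_mem ⊹ G.r_mem ⬝ G.r_mem ⬝ G.tbar_mem ⊹
      G.s_mem ⬝ G.t_mem ⬝ G.tbar_mem) ◃ G.X_filt :)

/-- Modulo `a₁`, `a₃` and the squares of the elements `s`, the cochain `W` is `t t`, and the
summands of `gLead` other than `W W` vanish. -/
theorem gLead_filt :
    K.gLead + K.t * K.t * (K.t * K.t) ∈ G.F 4 := by
  have h : K.m * K.r + K.s * K.n ∈ G.F 2 :=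
    (G.m_mem ◃ G.r_filt ∔ G.s_mem ◃ G.n_filt :)
  have h' := G.t_mem ⬝ G.t_mem ◃ h ∔ h ▹ G.W_mem ∔
    (G.lam_mem ⬝ G.s_mem ⊹ G.s_mem ⬝ G.lam_mem ⊹ G.t_mem ⬝ G.r_mem ⬝ G.tbar_mem) ◃ G.X_filt ∔
    G.s_mem ⬝ G.s_mem ⬝ G.t_mem ⬝ G.X_mem ◃ G.c_filt ∔
      G.a_mem ⬝ G.s_mem ⬝ G.s_mem ⬝ G.t_mem ◃ G.ρ_filt ∔
    G.s_mem ⬝ G.s_mem ⬝ G.c_mem ⬝ G.tbar_mem ◃ G.X_filt ∔ G.s_mem ⬝ G.t_mem ⬝ G.r_mem ◃ G.ρ_filt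
  convert h' using 1
  have hW : K.W * K.W + K.t * K.t * (K.t * K.t) =
      K.t * K.t * (K.m * K.r + K.s * K.n) +
        (K.m * K.r + K.s * K.n) * K.W := by
    apply eq_of_add
    simp only [CobarLetters.W, mul_add, add_mul, mul_assoc]
    abel_nf
    simp only [@zsmul_of_even R _ _, add_zero]
  rw [← hW, CobarLetters.gLead]
  abel

end Grading

end CobarLetters

namespace EllCobar

/-! ### The letters in the cobar complex -/

/-- The element `f` of `cochains n` represents the element `z` of the cobar complex. -/
def Rep (n : ℕ) (f : Str) (z : Cobar) : Prop := ∃ hf : f ∈ cochains n, mk n f hf = z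

namespace Rep

variable {n p q : ℕ} {f g : Str} {z w : Cobar}

theorem of_mem (hf : f ∈ cochains n) : Rep n f (mk n f hf) := ⟨hf, rfl⟩

theorem mul (hz : Rep p f z) (hw : Rep q g w) : Rep (p + q) (f * shift p g) (z * w) := by
  obtain ⟨hf, rfl⟩ := hz
  obtain ⟨hg, rfl⟩ := hw
  exact ⟨mul_mem (cochains_mono (by omega) hf) (shift_mem hg),
    (DirectSum.of_mul_of (A := Cochain) ⟨f, hf⟩ ⟨g, hg⟩).symm⟩

theorem add (hz : Rep p f z) (hw : Rep q g w) (h : q = p := by rfl) :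
    Rep p (f + g) (z + w) := by
  subst h
  obtain ⟨hf, rfl⟩ := hz
  obtain ⟨hg, rfl⟩ := hw
  exact ⟨add_mem hf hg, map_add (DirectSum.of Cochain q) ⟨f, hf⟩ ⟨g, hg⟩⟩

theorem diff (hz : Rep n f z) : Rep (n + 1) (delta n f) (diff z) := by
  obtain ⟨hf, rfl⟩ := hz
  exact ⟨delta_mem hf, (diff_mk hf).symm⟩

theorem ext (hz : Rep p f z) (hw : Rep q g w) (h : f = g) (hpq : p = q := by rfl) : z = w := by
  subst h hpq
  obtain ⟨hf, rfl⟩ := hz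
  obtain ⟨hg, rfl⟩ := hw
  rfl

theorem eq_zero (hz : Rep n f z) (h : f = 0) : z = 0 := by
  subst h
  obtain ⟨hf, rfl⟩ := hz
  exact map_zero (DirectSum.of Cochain n)

theorem mul_a (hz : Rep n f z) :
    z * mk 0 (gen Gen.a₁) (a₁_mem 0) = mk 0 (gen Gen.a₁) (a₁_mem 0) * z := by
  refine (hz.mul (of_mem (a₁_mem 0))).ext ((of_mem (a₁_mem 0)).mul hz) ?_ (by omega)
  rw [shift_a₁, shift_zero, mul_comm]

end Rep

theorem mul_mk_a₁ (z : Cobar) :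
    z * mk 0 (gen Gen.a₁) (a₁_mem 0) = mk 0 (gen Gen.a₁) (a₁_mem 0) * z := by
  induction z using DirectSum.induction_on with
  | zero => rw [zero_mul, mul_zero]
  | add z w hz hw => rw [add_mul, mul_add, hz, hw]
  | of n f => exact Rep.mul_a ⟨f.2, rfl⟩

theorem shift_rr (p : ℕ) (f g : Str) : shift p (rr f g) = rr (shift p f) (shift p g) :=
  map_rr (shift p : Str →+* Str) f g

instance : Nontrivial Str :=
  (lift (R := ZMod 2) 0 0 0 0 (fun i => by
    simp [rel₁, rel₂])).toRingHom.domain_nontrivial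

instance : CharP Str 2 :=
  charP_of_injective_algebraMap (algebraMap (ZMod 2) Str).injective 2

/-- The element `s t + a₁ t` of `Γ₀`. -/
noncomputable abbrev mm (a s t : Str) : Str := s * t + a * t

section Letters

local notation "A" => gen Gen.a₁
local notation "C" => gen Gen.a₃
local notation "S" => gen (Gen.s 0)
local notation "T" => gen (Gen.t 0)

theorem rep_a : Rep 0 A (mk 0 A (a₁_mem 0)) := .of_mem _
theorem rep_c : Rep 0 C (mk 0 C (a₃_mem 0)) := .of_mem _
theorem rep_s : Rep 1 S (mk 1 S (s_mem one_pos)) := .of_mem _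

theorem mem_r : rr A S ∈ cochains 1 := rr_mem (a₁_mem 1) (s_mem one_pos)
theorem mem_m : mm A S T ∈ cochains 1 :=
  add_mem (mul_mem (s_mem one_pos) (t_mem one_pos)) (mul_mem (a₁_mem 1) (t_mem one_pos))

theorem rep_r : Rep 1 (rr A S) (mk 1 (rr A S) mem_r) := .of_mem _
theorem rep_t : Rep 1 T (mk 1 T (t_mem one_pos)) := .of_mem _
theorem rep_y : Rep 1 (S * rr A S) (mk 1 (S * rr A S) (mul_mem (s_mem one_pos) mem_r)) :=
  .of_mem _
theorem rep_m : Rep 1 (mm A S T) (mk 1 (mm A S T) mem_m) := .of_mem _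
theorem rep_n : Rep 1 (rr A S * T) (mk 1 (rr A S * T) (mul_mem mem_r (t_mem one_pos))) :=
  .of_mem _
theorem rep_μ : Rep 1 (rr A S * mm A S T) (mk 1 (rr A S * mm A S T) (mul_mem mem_r mem_m)) :=
  .of_mem _

/-- The elements `a₁`, `a₃` and `s`, `r`, `t`, `s r`, `s t + a₁ t`, `r t`, `r (s t + a₁ t)` of the
cobar complex. -/
noncomputable def letters : CobarLetters Cobar where
  a := mk 0 A (a₁_mem 0)
  c := mk 0 C (a₃_mem 0)
  s := mk 1 S (s_mem one_pos)
  r := mk 1 (rr A S) mem_r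
  t := mk 1 T (t_mem one_pos)
  y := mk 1 (S * rr A S) (mul_mem (s_mem one_pos) mem_r)
  m := mk 1 (mm A S T) mem_m
  n := mk 1 (rr A S * T) (mul_mem mem_r (t_mem one_pos))
  μ := mk 1 (rr A S * mm A S T) (mul_mem mem_r mem_m)
  mul_a := mul_mk_a₁
  c_s := by
    refine (rep_c.mul rep_s).ext ((rep_s.mul rep_c).add (rep_a.mul rep_y)) ?_
    obtain ⟨h1, h2⟩ := gen_string
    simp only [shift_zero, shift_a₃, st, stage, mm]
    simp only [rel₁, rel₂, rr] at *
    grind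
  c_r := by
    refine (rep_c.mul rep_r).ext
      (((rep_r.mul rep_c).add (rep_a.mul (rep_s.mul rep_c))).add (rep_a.mul (rep_a.mul rep_t))) ?_
    obtain ⟨h1, h2⟩ := gen_string
    simp only [shift_zero, shift_a₃, st, stage, mm]
    simp only [rel₁, rel₂, rr] at *
    grind
  c_t := by
    refine (rep_c.mul rep_t).ext ((rep_t.mul rep_c).add (rep_a.mul rep_n)) ?_
    obtain ⟨h1, h2⟩ := gen_string
    simp only [shift_zero, shift_a₃, st, stage, mm]
    simp only [rel₁, rel₂, rr] at *
    grind
  c_y := by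
    refine (rep_c.mul rep_y).ext ((((rep_y.mul rep_c).add (rep_a.mul (rep_r.mul rep_c))).add
      (rep_a.mul (rep_a.mul (rep_s.mul rep_c)))).add
        (rep_a.mul (rep_a.mul (rep_a.mul rep_t))) |>.add (rep_a.mul (rep_a.mul rep_m))) ?_
    obtain ⟨h1, h2⟩ := gen_string
    simp only [shift_zero, shift_a₃, st, stage, mm]
    simp only [rel₁, rel₂, rr] at *
    grind
  c_m := by
    refine (rep_c.mul rep_m).ext ((rep_m.mul rep_c).add (rep_a.mul rep_μ)) ?_
    obtain ⟨h1, h2⟩ := gen_string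
    simp only [shift_zero, shift_a₃, st, stage, mm]
    simp only [rel₁, rel₂, rr] at *
    grind
  c_n := by
    refine (rep_c.mul rep_n).ext ((((rep_n.mul rep_c).add (rep_a.mul (rep_m.mul rep_c))).add
      (rep_a.mul (rep_a.mul (rep_y.mul rep_c)))).add
        (rep_a.mul (rep_a.mul (rep_a.mul rep_n)))) ?_
    obtain ⟨h1, h2⟩ := gen_string
    simp only [shift_zero, shift_a₃, st, stage, mm]
    simp only [rel₁, rel₂, rr] at *
    grind
  c_μ := by
    refine (rep_c.mul rep_μ).ext ((((((rep_μ.mul rep_c).add (rep_a.mul (rep_n.mul rep_c))).add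
      (rep_a.mul (rep_a.mul (rep_s.mul (rep_c.mul rep_c))))).add
        (rep_a.mul (rep_a.mul (rep_m.mul rep_c)))).add
          (rep_a.mul (rep_a.mul (rep_a.mul (rep_t.mul rep_c))))).add
            (rep_a.mul (rep_a.mul (rep_a.mul rep_μ)))) ?_
    obtain ⟨h1, h2⟩ := gen_string
    simp only [shift_zero, shift_a₃, map_mul, st, stage, mm]
    simp only [rel₁, rel₂, rr] at *
    grind
  diff_a := rep_a.diff.eq_zero delta_a₁
  diff_c := by
    refine rep_c.diff.ext (rep_a.mul rep_r) ?_
    simp only [delta, Finset.sum_range_succ, Finset.sum_range_zero, coface_a₃, faceA, st, stage,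
      shift_zero]
    grind
  diff_s := rep_s.diff.eq_zero delta_s
  diff_r := rep_r.diff.eq_zero delta_r
  diff_t := by
    refine rep_t.diff.ext (rep_s.mul rep_r) ?_
    simp [delta, Finset.sum_range_succ, coface_t, coface_s, coface_rr, faceS, faceT, shift_rr]
    grind
  diff_y := by
    refine rep_y.diff.ext ((rep_s.mul rep_r).add (rep_r.mul rep_s)) ?_
    simp [delta, Finset.sum_range_succ, coface_t, coface_s, coface_rr, faceS, faceT, shift_rr, mm]
    simp only [rr]
    grind
  diff_m := by
    refine rep_m.diff.ext ((((rep_r.mul rep_r).add (rep_t.mul rep_s)).add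
      (rep_s.mul rep_t)).add (rep_s.mul rep_y)) ?_
    simp [delta, Finset.sum_range_succ, coface_t, coface_s, coface_rr, faceS, faceT, shift_rr, mm]
    simp only [rr]
    grind
  diff_n := by
    refine rep_n.diff.ext (((((rep_r.mul rep_t).add (rep_t.mul rep_r)).add (rep_y.mul rep_r)).add
      (rep_s.mul (rep_s.mul rep_c))).add (rep_a.mul (rep_s.mul rep_t))) ?_
    have h1 := (isString_gen 1).1
    simp [delta, Finset.sum_range_succ, coface_t, coface_s, coface_rr, faceS, faceT, shift_rr, mm,
      shift_comp, shift_zero, st, stage]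
    simp only [rel₁, rel₂, rr, stage] at *
    grind
  diff_μ := by
    refine rep_μ.diff.ext (((((((((((rep_s.mul rep_n).add (rep_n.mul rep_s)).add
      (rep_y.mul rep_y)).add (rep_y.mul rep_t)).add (rep_t.mul rep_y)).add (rep_r.mul rep_m)).add
      (rep_m.mul rep_r)).add (rep_r.mul (rep_s.mul rep_c))).add (rep_a.mul (rep_s.mul rep_m))).add
      (rep_a.mul (rep_r.mul rep_t))).add (rep_a.mul (rep_t.mul rep_r))) ?_
    have h0 := gen_string.1
    have h1 := (isString_gen 1).1
    simp [delta, Finset.sum_range_succ, coface_t, coface_s, coface_rr, faceS, faceT, shift_rr, mm,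
      shift_comp, shift_zero, st, stage]
    simp only [rel₁, rel₂, rr, stage] at *
    grind

end Letters

/-! ### Cohomology classes -/

theorem mk_xCochain : mk 1 xCochain xCochain_mem = letters.X := by
  refine (Rep.of_mem xCochain_mem).ext ((rep_s.mul rep_c).add (rep_a.mul rep_t)) ?_
  simp only [xCochain, shift_a₃, shift_zero, st, stage]
  ring

theorem mk_discr : mk 0 discr discr_mem = letters.disc := by
  refine (Rep.of_mem discr_mem).ext ((((rep_c.mul rep_c).mul rep_c).mul rep_c).add
    (((((rep_a.mul rep_a).mul rep_a).mul rep_c).mul rep_c).mul rep_c)) ?_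
  simp only [discr, add_zero, shift_zero]
  ring

theorem diff_disc : diff letters.disc = 0 := by
  rw [← mk_discr]; exact diff_mk_eq_zero _ delta_discr

namespace Coh

theorem x_eq : x = cls letters.X letters.diff_X := by simp only [x, mk_xCochain]
theorem Δ_eq : Δ = cls letters.disc diff_disc := by simp only [Δ, mk_discr]
theorem a₁_eq : a₁ = cls letters.a letters.diff_a := rfl
theorem h₁_eq : h₁ = cls letters.s letters.diff_s := rfl
theorem h₂_eq : h₂ = cls letters.r letters.diff_r := rfl

theorem mul_a₁ (ζ : H) : ζ * a₁ = a₁ * ζ := by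
  obtain ⟨z, hz, rfl⟩ := exists_cls ζ
  rw [a₁_eq, cls_mul, cls_mul]
  exact cls_congr _ _ (letters.mul_a z)

theorem x_mul_h₂ : x * h₂ = a₁ * x * h₁ := by
  rw [x_eq, h₂_eq, a₁_eq, h₁_eq, cls_mul, cls_mul, cls_mul]
  exact cls_eq _ _ letters.X_mul_r

theorem d_mul_h₂ : d * h₂ = a₁ * d * h₁ := by
  rw [d, pow_two, mul_assoc, x_mul_h₂, ← mul_assoc, ← mul_assoc, mul_a₁, ← mul_assoc]

theorem h₁_mul_x : h₁ * x = x * h₁ := by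
  rw [x_eq, h₁_eq, cls_mul, cls_mul]
  exact cls_eq _ _ letters.s_mul_X

end Coh

/-! ### Internal degrees -/

theorem aeval_mem_graded {B : Type*} [CommRing B] [Algebra (ZMod 2) B]
    (N : ℕ → Submodule (ZMod 2) B) [SetLike.GradedMonoid N] {φ : Gen → B}
    (hφ : ∀ v, φ v ∈ N v.weight) {m : ℕ} {P : MvPolynomial Gen (ZMod 2)}
    (hP : MvPolynomial.IsWeightedHomogeneous Gen.weight P m) : MvPolynomial.aeval φ P ∈ N m := by
  classical
  rw [P.as_sum, map_sum]
  refine Submodule.sum_mem _ fun e he => ?_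
  rw [MvPolynomial.aeval_monomial, ← Algebra.smul_def]
  refine Submodule.smul_mem _ _ ?_
  rw [← hP (MvPolynomial.mem_support_iff.1 he), Finsupp.weight_apply, Finsupp.prod, Finsupp.sum]
  exact SetLike.prod_mem_graded _ _ _ fun v _ => SetLike.pow_mem_graded _ (hφ v)

instance : SetLike.GradedMonoid internal where
  one_mem := ⟨1, MvPolynomial.isWeightedHomogeneous_one _ _, map_one proj⟩
  mul_mem := by
    rintro m k _ _ ⟨P, hP, rfl⟩ ⟨Q, hQ, rfl⟩
    exact ⟨P * Q, MvPolynomial.IsWeightedHomogeneous.mul hP hQ, map_mul proj P Q⟩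

theorem gen_mem_internal (v : Gen) : gen v ∈ internal v.weight :=
  ⟨MvPolynomial.X v, MvPolynomial.isWeightedHomogeneous_X _ _ v, rfl⟩

theorem algHom_mem_graded {B : Type*} [CommRing B] [Algebra (ZMod 2) B]
    (N : ℕ → Submodule (ZMod 2) B) [SetLike.GradedMonoid N] (φ : Str →ₐ[ZMod 2] B)
    (hφ : ∀ v, φ (gen v) ∈ N v.weight) {m : ℕ} {f : Str} (hf : f ∈ internal m) : φ f ∈ N m := by
  obtain ⟨P, hP, rfl⟩ := hf
  have : φ (proj P) = MvPolynomial.aeval (fun v => φ (gen v)) P := by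
    rw [← AlgHom.comp_apply]
    congr 1
    apply MvPolynomial.algHom_ext
    intro v
    simp [gen]
  exact this ▸ aeval_mem_graded N hφ hP

theorem rr_mem_internal {f g : Str} (hf : f ∈ internal 2) (hg : g ∈ internal 2) :
    rr f g ∈ internal 4 :=
  add_mem (SetLike.pow_mem_graded 2 hg) (SetLike.mul_mem_graded hf hg)

theorem st_mem_internal (i : ℕ) : st i ∈ internal 6 := by
  induction i with
  | zero => exact gen_mem_internal Gen.a₃
  | succ i ih =>
    exact add_mem ih (SetLike.mul_mem_graded (gen_mem_internal Gen.a₁)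
      (rr_mem_internal (gen_mem_internal Gen.a₁) (gen_mem_internal (Gen.s i))))

theorem shift_mem_internal (p : ℕ) {m : ℕ} {f : Str} (hf : f ∈ internal m) :
    shift p f ∈ internal m := by
  refine algHom_mem_graded internal (shift p) ?_ hf
  rintro (_ | _ | i | i)
  · rw [shift_a₁]; exact gen_mem_internal _
  · rw [shift_a₃]; exact st_mem_internal _
  · rw [shift_s]; exact gen_mem_internal (Gen.s (i + p))
  · rw [shift_t]; exact gen_mem_internal (Gen.t (i + p))

theorem coface_mem_internal (j : ℕ) {m : ℕ} {f : Str} (hf : f ∈ internal m) :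
    coface j f ∈ internal m := by
  have hs : ∀ i, gen (Gen.s i) ∈ internal 2 := fun i => gen_mem_internal (Gen.s i)
  have ht : ∀ i, gen (Gen.t i) ∈ internal 6 := fun i => gen_mem_internal (Gen.t i)
  refine algHom_mem_graded internal (coface j) ?_ hf
  rintro (_ | _ | i | i)
  · rw [coface_a₁]; exact gen_mem_internal _
  · rw [coface_a₃, faceA]
    split_ifs
    exacts [st_mem_internal _, gen_mem_internal Gen.a₃]
  · rw [coface_s, faceS]
    split_ifs
    exacts [hs _, add_mem (hs _) (hs _), hs _]
  · rw [coface_t, faceT]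
    split_ifs
    exacts [ht _, add_mem (add_mem (ht _) (ht _)) (SetLike.mul_mem_graded (hs _)
      (rr_mem_internal (gen_mem_internal Gen.a₁) (hs _))), ht _]

section Grading

open Polynomial

theorem isString_scale : IsString (C (gen Gen.a₁) * X ^ 2) (C (gen Gen.a₃) * X ^ 6)
    (fun i => C (gen (Gen.s i)) * X ^ 2) (fun i => C (gen (Gen.t i)) * X ^ 6) := by
  have hst : ∀ i, stage (C (gen Gen.a₁) * X ^ 2) (C (gen Gen.a₃) * X ^ 6)
      (fun i => C (gen (Gen.s i)) * X ^ 2) i = C (st i) * X ^ 6 := by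
    intro i
    induction i with
    | zero => rfl
    | succ i ih =>
      rw [stage, ih, show st (i + 1) = st i + gen Gen.a₁ * rr (gen Gen.a₁) (gen (Gen.s i)) from rfl]
      simp only [rr, map_add, map_mul, map_pow]
      ring
  intro i
  rw [hst]
  have h1 := congrArg (fun f : Str => C f * X ^ 8) (isString_gen i).1
  have h2 := congrArg (fun f : Str => C f * X ^ 12) (isString_gen i).2
  change C (rel₁ _ (st i) _ _) * X ^ 8 = _ at h1
  change C (rel₂ _ (st i) _ _) * X ^ 12 = _ at h2
  simp only [rel₁, rel₂, map_add, map_mul, map_pow, map_zero, zero_mul] at *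
  exact ⟨by rw [← h1]; ring, by rw [← h2]; ring⟩

/-- The coaction `f ↦ f X ^ m` (for `f` of internal degree `m`) that encodes the internal
grading. -/
noncomputable def scale : Str →ₐ[ZMod 2] Str[X] := lift _ _ _ _ isString_scale

theorem scale_gen (v : Gen) : scale (gen v) = C (gen v) * X ^ v.weight := by
  rw [scale, lift_gen]
  cases v <;> rfl

/-- The polynomials `f X ^ m`. -/
noncomputable def monomials (m : ℕ) : Submodule (ZMod 2) Str[X] :=
  (LinearMap.range (monomial (R := Str) m)).restrictScalars (ZMod 2)

theorem mem_monomials {m : ℕ} {p : Str[X]} : p ∈ monomials m ↔ ∃ f, monomial m f = p := Iff.rfl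

instance : SetLike.GradedMonoid monomials where
  one_mem := ⟨1, rfl⟩
  mul_mem := by
    rintro m k _ _ ⟨f, rfl⟩ ⟨g, rfl⟩
    exact ⟨f * g, (monomial_mul_monomial _ _ _ _).symm⟩

theorem eval_scale (f : Str) : (scale f).eval 1 = f := by
  have : (((aeval (R := Str) (1 : Str)).restrictScalars (ZMod 2)).comp scale) =
      AlgHom.id (ZMod 2) Str := by
    apply algHom_ext
    intro v
    simp [scale_gen]
  simpa [coe_aeval_eq_eval] using DFunLike.congr_fun this f

theorem scale_of_mem_internal {m : ℕ} {f : Str} (hf : f ∈ internal m) :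
    scale f = monomial m f := by
  obtain ⟨f', hf'⟩ := mem_monomials.1 (algHom_mem_graded monomials scale
    (fun v => ⟨gen v, by rw [scale_gen, C_mul_X_pow_eq_monomial]⟩) hf)
  have := eval_scale f
  rw [← hf', eval_monomial, one_pow, mul_one] at this
  rw [← hf', this]

/-- The homogeneous component of internal degree `m`. -/
noncomputable def component (m : ℕ) (f : Str) : Str := (scale f).coeff m

theorem component_add (m : ℕ) (f g : Str) :
    component m (f + g) = component m f + component m g := by
  simp [component]

theorem component_of_mem {m : ℕ} {f : Str} (hf : f ∈ internal m) : component m f = f := by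
  rw [component, scale_of_mem_internal hf, coeff_monomial, if_pos rfl]

theorem component_of_mem_of_ne {m k : ℕ} (h : k ≠ m) {f : Str} (hf : f ∈ internal k) :
    component m f = 0 := by
  rw [component, scale_of_mem_internal hf, coeff_monomial, if_neg h]

theorem component_coface (m j : ℕ) (f : Str) :
    component m (coface j f) = coface j (component m f) := by
  have : scale.comp (coface j) = (mapAlgHom (coface j)).comp scale := by
    apply algHom_ext
    intro v
    simp only [AlgHom.comp_apply]
    rw [scale_of_mem_internal (coface_mem_internal j (gen_mem_internal v)),
      scale_of_mem_internal (gen_mem_internal v)]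
    simp
  have := congrArg (fun p => coeff p m) (DFunLike.congr_fun this f)
  simpa [component] using this

theorem component_delta (m n : ℕ) (f : Str) :
    component m (delta n f) = delta n (component m f) := by
  have h : component m (delta n f) = ∑ j ∈ Finset.range (n + 2), component m (coface j f) := by
    simp [component, delta]
  rw [h]
  simp only [component_coface]
  rfl

end Grading

/-! ### Cochains of degree zero -/

/-- The field with four elements. -/
abbrev F₄ : Type := QuadraticAlgebra (ZMod 2) 1 1

/-- The field with sixteen elements, generated over `F₄` by a root `z` of `z² + z = ω`. -/
abbrev F₁₆ : Type := QuadraticAlgebra F₄ ⟨0, 1⟩ 1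

/-- A point of `Str` over `F₁₆`: the string that starts with the morphism given by `a₁ = 1`,
`s = z`, `a₃ = (s² + s) (s + ω)` and consists of identities afterwards. Its value of `r` is `ω`. -/
theorem isString_point : IsString (1 : F₁₆) ⟨⟨1, 1⟩, ⟨0, 1⟩⟩
    (fun i => if i = 0 then ⟨0, 1⟩ else 0) (fun i => if i = 0 then
      (⟨0, 1⟩ : F₁₆) ^ 4 + ⟨0, 1⟩ ^ 3 + ⟨⟨1, 1⟩, ⟨0, 1⟩⟩ * ⟨0, 1⟩ else 0) := by
  rintro (_ | i)
  · simp only [stage, rel₁, rel₂, if_true]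
    decide
  · simp [rel₁, rel₂]

/-- The elements `a₁⁴ r` and `a₁² r²` of `Γ₀` are linearly independent, as they take the values `ω`
and `ω²` at the point above. -/
theorem smul_r_add_smul_X {β γ : ZMod 2}
    (h : β • (gen Gen.a₁ ^ 4 * rr (gen Gen.a₁) (gen (Gen.s 0))) +
      γ • (gen Gen.a₁ ^ 2 * rr (gen Gen.a₁) (gen (Gen.s 0)) ^ 2) = 0) : β = 0 ∧ γ = 0 := by
  have h' := congrArg (lift _ _ _ _ isString_point) h
  simp only [map_add, map_smul, map_mul, map_pow, rr, lift_gen, Gen.val, map_zero, if_true] at h'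
  clear h
  revert h'
  revert β γ
  decide

/-- The components of a cochain of degree zero are polynomials in `a₁` and `a₃`. -/
theorem component_cochains_zero (m : ℕ) {f : Str} (hf : f ∈ cochains 0) :
    component m f ∈ Submodule.span (ZMod 2)
      {e | ∃ i j, 2 * i + 6 * j = m ∧ e = gen Gen.a₁ ^ i * gen Gen.a₃ ^ j} := by
  have h0 : ({gen Gen.a₁, gen Gen.a₃} ∪ {f | ∃ i < 0, f = gen (Gen.s i) ∨ f = gen (Gen.t i)}) =
      {gen Gen.a₁, gen Gen.a₃} := by simp
  rw [cochains, h0, ← Subalgebra.mem_toSubmodule, Algebra.adjoin_eq_span] at hf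
  induction hf using Submodule.span_induction with
  | mem x hx =>
    obtain ⟨i, j, rfl⟩ := (Submonoid.mem_closure_pair _ _ _).1 hx
    have hij : gen Gen.a₁ ^ i * gen Gen.a₃ ^ j ∈ internal (2 * i + 6 * j) := by
      have := SetLike.mul_mem_graded (SetLike.pow_mem_graded i (gen_mem_internal Gen.a₁))
        (SetLike.pow_mem_graded j (gen_mem_internal Gen.a₃))
      rwa [smul_eq_mul, smul_eq_mul, mul_comm i, mul_comm j] at this
    by_cases h : 2 * i + 6 * j = m
    · subst h
      rw [component_of_mem hij]
      exact Submodule.subset_span ⟨i, j, rfl, rfl⟩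
    · rw [component_of_mem_of_ne h hij]
      exact zero_mem _
  | zero => simp [component]
  | add x y _ _ hx hy => rw [component_add]; exact add_mem hx hy
  | smul k x _ hx =>
    have : component m (k • x) = k • component m x := by simp [component]
    rw [this]
    exact Submodule.smul_mem _ _ hx

theorem component_mem_cochains_zero (m : ℕ) {f : Str} (hf : f ∈ cochains 0) :
    component m f ∈ cochains 0 := by
  have hle : Submodule.span (ZMod 2)
      {e | ∃ i j, 2 * i + 6 * j = m ∧ e = gen Gen.a₁ ^ i * gen Gen.a₃ ^ j} ≤
        Subalgebra.toSubmodule (cochains 0) := by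
    rw [Submodule.span_le]
    rintro _ ⟨i, j, -, rfl⟩
    exact Subalgebra.mul_mem _ (pow_mem (a₁_mem 0) i) (pow_mem (a₃_mem 0) j)
  exact hle (component_cochains_zero m hf)

theorem Rep.smul {n : ℕ} {f : Str} {z : Cobar} (k : ZMod 2) (hz : Rep n f z) :
    Rep n (k • f) (k • z) := by
  obtain ⟨hf, rfl⟩ := hz
  exact ⟨Subalgebra.smul_mem _ hf k,
    map_smul (DirectSum.lof (ZMod 2) ℕ (fun n => Cochain n) n) k ⟨f, hf⟩⟩

theorem Rep.inj {n : ℕ} {f g : Str} {z : Cobar} (hz : Rep n f z) (hw : Rep n g z) : f = g := by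
  obtain ⟨hf, rfl⟩ := hz
  obtain ⟨hg, h⟩ := hw
  exact (congrArg Subtype.val (DirectSum.of_injective (β := Cochain) n h)).symm

/-- The cobar cochains of degree zero that are combinations of the monomials of internal degree
`m`. -/
def Homog (m : ℕ) (z : Cobar) : Prop := ∃ f ∈ cochains 0, Rep 0 (component m f) z

theorem homog_of_mem_bicochains {m : ℕ} {z : Cobar} (hz : z ∈ bicochains 0 m) : Homog m z := by
  obtain ⟨f, hf, hm, rfl⟩ := hz
  exact ⟨f, hf, by rw [component_of_mem hm]; exact .of_mem hf⟩

theorem cobarDiff_apply_zero (w : Cobar) : cobarDiff w 0 = 0 := by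
  induction w using DirectSum.induction_on with
  | zero => rw [map_zero]; rfl
  | add z w hz hw => rw [map_add, DirectSum.add_apply, hz, hw, add_zero]
  | of n f => rw [cobarDiff_of]; exact DirectSum.of_eq_of_ne _ _ _ (by omega)

theorem cobarDiff_apply_succ (w : Cobar) (n : ℕ) : cobarDiff w (n + 1) = deltaHom n (w n) := by
  induction w using DirectSum.induction_on with
  | zero => rw [map_zero, DirectSum.zero_apply, DirectSum.zero_apply, map_zero]
  | add z w hz hw => rw [map_add, DirectSum.add_apply, DirectSum.add_apply, map_add, hz, hw]
  | of k f =>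
    rw [cobarDiff_of]
    rcases eq_or_ne n k with rfl | h
    · rw [DirectSum.of_eq_same, DirectSum.of_eq_same]
    · rw [DirectSum.of_eq_of_ne _ _ _ (by omega), DirectSum.of_eq_of_ne _ _ _ h, map_zero]

/-- Nothing but `0` of cohomological degree zero is a coboundary. -/
theorem eq_zero_of_eq_diff {f : Str} {z w : Cobar} (hz : Rep 0 f z) (h : diff w = z) : z = 0 := by
  obtain ⟨hf, rfl⟩ := hz
  have h0 := cobarDiff_apply_zero w
  rw [show cobarDiff w = mk 0 f hf from h, mk, DirectSum.of_eq_same] at h0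
  rw [mk, h0, map_zero]

/-- A homogeneous coboundary of cohomological degree one is the coboundary of a homogeneous
cochain. -/
theorem exists_homog_of_eq_diff {m : ℕ} {z w : Cobar} (hz : z ∈ bicochains 1 m)
    (h : diff w = z) : ∃ w', Homog m w' ∧ diff w' = z := by
  obtain ⟨f, hf, hm, rfl⟩ := hz
  have h1 := cobarDiff_apply_succ w 0
  rw [show cobarDiff w = mk 1 f hf from h, mk, DirectSum.of_eq_same] at h1
  have h2 : f = delta 0 (w 0).1 := congrArg Subtype.val h1
  have hw := component_mem_cochains_zero m (w 0).2
  refine ⟨_, ⟨_, (w 0).2, .of_mem hw⟩, ?_⟩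
  refine (Rep.of_mem hw).diff.ext (.of_mem hf) ?_
  rw [← component_delta, ← h2, component_of_mem hm]

theorem Homog.four {z : Cobar} (hz : Homog 4 z) :
    ∃ α : ZMod 2, z = α • (letters.a * letters.a) := by
  obtain ⟨f, hf, hz⟩ := hz
  have hs : {e : Str | ∃ i j, 2 * i + 6 * j = 4 ∧ e = gen Gen.a₁ ^ i * gen Gen.a₃ ^ j} ⊆
      {gen Gen.a₁ ^ 2} := by
    rintro _ ⟨i, j, hij, rfl⟩
    obtain ⟨rfl, rfl⟩ : i = 2 ∧ j = 0 := by omega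
    simp
  obtain ⟨α, h⟩ := Submodule.mem_span_singleton.1
    (Submodule.span_mono hs (component_cochains_zero 4 hf))
  refine ⟨α, hz.ext ((rep_a.mul rep_a).smul α) ?_⟩
  simp only [← h, shift_zero, pow_succ, pow_zero, one_mul]

theorem Homog.eight {z : Cobar} (hz : Homog 8 z) : ∃ α β : ZMod 2,
    z = α • (letters.a * (letters.a * (letters.a * letters.a))) +
      β • (letters.a * letters.c) := by
  obtain ⟨f, hf, hz⟩ := hz
  have hs : {e : Str | ∃ i j, 2 * i + 6 * j = 8 ∧ e = gen Gen.a₁ ^ i * gen Gen.a₃ ^ j} ⊆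
      {gen Gen.a₁ ^ 4, gen Gen.a₁ * gen Gen.a₃} := by
    rintro _ ⟨i, j, hij, rfl⟩
    obtain ⟨rfl, rfl⟩ | ⟨rfl, rfl⟩ : (i = 4 ∧ j = 0) ∨ (i = 1 ∧ j = 1) := by omega
    all_goals simp
  obtain ⟨α, β, h⟩ := Submodule.mem_span_pair.1
    (Submodule.span_mono hs (component_cochains_zero 8 hf))
  refine ⟨α, β, hz.ext (((rep_a.mul (rep_a.mul (rep_a.mul rep_a))).smul α).add
    ((rep_a.mul rep_c).smul β)) ?_⟩
  simp only [← h, shift_zero, pow_succ, pow_zero, one_mul, mul_assoc]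

theorem Homog.twelve {z : Cobar} (hz : Homog 12 z) : ∃ α β γ : ZMod 2,
    z = α • (letters.a * (letters.a * (letters.a * (letters.a * (letters.a * letters.a))))) +
      β • (letters.a * (letters.a * (letters.a * letters.c))) + γ • (letters.c * letters.c) := by
  obtain ⟨f, hf, hz⟩ := hz
  have hs : {e : Str | ∃ i j, 2 * i + 6 * j = 12 ∧ e = gen Gen.a₁ ^ i * gen Gen.a₃ ^ j} ⊆
      {gen Gen.a₁ ^ 6, gen Gen.a₁ ^ 3 * gen Gen.a₃, gen Gen.a₃ ^ 2} := by
    rintro _ ⟨i, j, hij, rfl⟩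
    obtain ⟨rfl, rfl⟩ | ⟨rfl, rfl⟩ | ⟨rfl, rfl⟩ :
      (i = 6 ∧ j = 0) ∨ (i = 3 ∧ j = 1) ∨ (i = 0 ∧ j = 2) := by omega
    all_goals simp
  obtain ⟨α, β, γ, h⟩ := Submodule.mem_span_triple.1
    (Submodule.span_mono hs (component_cochains_zero 12 hf))
  refine ⟨α, β, γ, hz.ext
    ((((rep_a.mul (rep_a.mul (rep_a.mul (rep_a.mul (rep_a.mul rep_a))))).smul α).add
      ((rep_a.mul (rep_a.mul (rep_a.mul rep_c))).smul β)).add ((rep_c.mul rep_c).smul γ)) ?_⟩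
  simp only [← h, shift_zero, pow_succ, pow_zero, one_mul, mul_assoc]

theorem rep_X : Rep 1 (rr (gen Gen.a₁) (gen (Gen.s 0)) ^ 2) letters.X :=
  ⟨pow_mem mem_r 2, by rw [← mk_xCochain]; congr 1; exact xCochain_eq.symm⟩

/-- The cocycles `a₁⁴ r` and `a₁² X` of the cobar complex are linearly independent. -/
theorem smul_letters_r_add_smul_X {β γ : ZMod 2}
    (h : β • (letters.a * (letters.a * (letters.a * (letters.a * letters.r)))) +
      γ • (letters.a * (letters.a * letters.X)) = 0) : β = 0 ∧ γ = 0 := by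
  have hr := ((rep_a.mul (rep_a.mul (rep_a.mul (rep_a.mul rep_r)))).smul β).add
    ((rep_a.mul (rep_a.mul rep_X)).smul γ)
  have h0 : Rep 1 0 (0 : Cobar) := ⟨zero_mem _, map_zero _⟩
  refine smul_r_add_smul_X (Eq.trans ?_ (Rep.inj (h ▸ hr) h0))
  simp only [shift_zero, pow_succ, pow_zero, one_mul, mul_assoc]

/-! ### Bihomogeneous cochains -/

theorem mul_mem_bicochains {n m p q : ℕ} {z w : Cobar} (hz : z ∈ bicochains n m)
    (hw : w ∈ bicochains p q) : z * w ∈ bicochains (n + p) (m + q) := by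
  obtain ⟨f, hf, hm, rfl⟩ := hz
  obtain ⟨g, hg, hq, rfl⟩ := hw
  obtain ⟨hfg, h⟩ := (Rep.of_mem hf).mul (.of_mem hg)
  exact ⟨_, hfg, SetLike.mul_mem_graded hm (shift_mem_internal n hq), h⟩

theorem add_mem_bicochains {n m p q : ℕ} {z w : Cobar} (hz : z ∈ bicochains n m)
    (hw : w ∈ bicochains p q) (hn : p = n := by rfl) (hm : q = m := by rfl) :
    z + w ∈ bicochains n m := by
  subst hn hm
  obtain ⟨f, hf, hm, rfl⟩ := hz
  obtain ⟨g, hg, hq, rfl⟩ := hw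
  obtain ⟨hfg, h⟩ := (Rep.of_mem hf).add (.of_mem hg)
  exact ⟨_, hfg, add_mem hm hq, h⟩

theorem letters_a_mem : letters.a ∈ bicochains 0 2 := ⟨_, _, gen_mem_internal Gen.a₁, rfl⟩
theorem letters_c_mem : letters.c ∈ bicochains 0 6 := ⟨_, _, gen_mem_internal Gen.a₃, rfl⟩
theorem letters_s_mem : letters.s ∈ bicochains 1 2 := ⟨_, _, gen_mem_internal (Gen.s 0), rfl⟩

theorem r_mem_internal : rr (gen Gen.a₁) (gen (Gen.s 0)) ∈ internal 4 :=
  rr_mem_internal (gen_mem_internal Gen.a₁) (gen_mem_internal (Gen.s 0))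
theorem m_mem_internal : mm (gen Gen.a₁) (gen (Gen.s 0)) (gen (Gen.t 0)) ∈ internal 8 :=
  add_mem (SetLike.mul_mem_graded (gen_mem_internal (Gen.s 0)) (gen_mem_internal (Gen.t 0)))
    (SetLike.mul_mem_graded (gen_mem_internal Gen.a₁) (gen_mem_internal (Gen.t 0)))

theorem letters_r_mem : letters.r ∈ bicochains 1 4 := ⟨_, _, r_mem_internal, rfl⟩
theorem letters_t_mem : letters.t ∈ bicochains 1 6 := ⟨_, _, gen_mem_internal (Gen.t 0), rfl⟩
theorem letters_y_mem : letters.y ∈ bicochains 1 6 :=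
  ⟨_, _, SetLike.mul_mem_graded (gen_mem_internal (Gen.s 0)) r_mem_internal, rfl⟩
theorem letters_m_mem : letters.m ∈ bicochains 1 8 := ⟨_, _, m_mem_internal, rfl⟩
theorem letters_n_mem : letters.n ∈ bicochains 1 10 :=
  ⟨_, _, SetLike.mul_mem_graded r_mem_internal (gen_mem_internal (Gen.t 0)), rfl⟩
theorem letters_μ_mem : letters.μ ∈ bicochains 1 12 :=
  ⟨_, _, SetLike.mul_mem_graded r_mem_internal m_mem_internal, rfl⟩

/-! ### The leading term of `g` -/

/-- The ideal generated by `a₁`, `a₃` and the squares of the elements `s` of the first `n`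
factors. -/
noncomputable def filtIdeal (n : ℕ) : Ideal Str :=
  Ideal.span ({gen Gen.a₁, gen Gen.a₃} ∪ {e | ∃ i < n, e = gen (Gen.s i) ^ 2})

theorem a₁_mem_filtIdeal (n : ℕ) : gen Gen.a₁ ∈ filtIdeal n := Ideal.subset_span (by simp)
theorem a₃_mem_filtIdeal (n : ℕ) : gen Gen.a₃ ∈ filtIdeal n := Ideal.subset_span (by simp)

theorem r_mem_filtIdeal : rr (gen Gen.a₁) (gen (Gen.s 0)) ∈ filtIdeal 1 :=
  add_mem (Ideal.subset_span (Or.inr ⟨0, one_pos, rfl⟩))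
    (Ideal.mul_mem_right _ _ (a₁_mem_filtIdeal 1))

theorem filtIdeal_mono {n m : ℕ} (h : n ≤ m) : filtIdeal n ≤ filtIdeal m := by
  refine Ideal.span_mono (Set.union_subset_union_right _ ?_)
  rintro _ ⟨i, hi, rfl⟩
  exact ⟨i, hi.trans_le h, rfl⟩

theorem shift_mem_filtIdeal (p : ℕ) {q : ℕ} {f : Str} (hf : f ∈ filtIdeal q) :
    shift p f ∈ filtIdeal (p + q) := by
  have hst : ∀ i, st i ∈ filtIdeal (p + q) := by
    intro i
    induction i with
    | zero => exact a₃_mem_filtIdeal _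
    | succ i ih => exact add_mem ih (Ideal.mul_mem_right _ _ (a₁_mem_filtIdeal _))
  have hle : filtIdeal q ≤ (filtIdeal (p + q)).comap (shift p) := by
    refine Ideal.span_le.2 ?_
    rintro _ ((rfl | rfl) | ⟨i, hi, rfl⟩)
    · simpa using a₁_mem_filtIdeal _
    · simpa using hst p
    · exact Ideal.subset_span (Or.inr ⟨i + p, by omega, by simp⟩)
  exact hle hf

/-- The cobar cochains of degree `n` that vanish modulo `a₁`, `a₃` and the squares of the elements
`s`. -/
def Filt (n : ℕ) (z : Cobar) : Prop := ∃ f ∈ filtIdeal n, Rep n f z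

namespace Filt

variable {n m p q : ℕ} {z w : Cobar}

theorem mul_left (hz : z ∈ bicochains n m) (hw : Filt q w) : Filt (n + q) (z * w) := by
  obtain ⟨f, hf, hm, rfl⟩ := hz
  obtain ⟨g, hg, hw⟩ := hw
  exact ⟨_, Ideal.mul_mem_left _ _ (shift_mem_filtIdeal n hg), (Rep.of_mem hf).mul hw⟩

theorem mul_right (hz : Filt q z) (hw : w ∈ bicochains n m) : Filt (q + n) (z * w) := by
  obtain ⟨f, hf, hm, rfl⟩ := hw
  obtain ⟨g, hg, hz⟩ := hz
  exact ⟨_, Ideal.mul_mem_right _ _ (filtIdeal_mono (by omega) hg), hz.mul (.of_mem hf)⟩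

theorem add (hz : Filt p z) (hw : Filt q w) (h : q = p := by rfl) : Filt p (z + w) := by
  subst h
  obtain ⟨f, hf, hz⟩ := hz
  obtain ⟨g, hg, hw⟩ := hw
  exact ⟨_, add_mem hf hg, hz.add hw⟩

end Filt

theorem filt_a : Filt 0 letters.a := ⟨_, a₁_mem_filtIdeal 0, rep_a⟩
theorem filt_c : Filt 0 letters.c := ⟨_, a₃_mem_filtIdeal 0, rep_c⟩
theorem filt_r : Filt 1 letters.r := ⟨_, r_mem_filtIdeal, rep_r⟩
theorem filt_n : Filt 1 letters.n := ⟨_, Ideal.mul_mem_right _ _ r_mem_filtIdeal, rep_n⟩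

/-- The bigrading of the cobar complex, with the filtration `Filt`. -/
noncomputable def grading : letters.Grading where
  B := bicochains
  F n := {z | Filt n z}
  mul := mul_mem_bicochains
  add hz hw := add_mem_bicochains hz hw
  mul_left := Filt.mul_left
  mul_right := Filt.mul_right
  addF hz hw := Filt.add hz hw
  a_mem := letters_a_mem
  c_mem := letters_c_mem
  s_mem := letters_s_mem
  r_mem := letters_r_mem
  t_mem := letters_t_mem
  y_mem := letters_y_mem
  m_mem := letters_m_mem
  n_mem := letters_n_mem
  μ_mem := letters_μ_mem
  a_filt := filt_a
  c_filt := filt_c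
  r_filt := filt_r
  n_filt := filt_n

theorem isLiftOfGenerator_g : Coh.IsLiftOfGenerator (cls letters.g letters.diff_g) := by
  obtain ⟨f, hf, hm, hg⟩ := grading.g_mem
  obtain ⟨e, he, h⟩ := Filt.add grading.gLead_filt grading.gCorr_filt
  have hz : diff (mk 4 f hf) = 0 := hg ▸ letters.diff_g
  refine ⟨f, hf, hz, hm, cls_congr _ _ hg, ?_⟩
  have ht := (rep_t.mul rep_t).mul (rep_t.mul rep_t)
  have hsum : letters.g + letters.t * letters.t * (letters.t * letters.t) =
      letters.gLead + letters.t * letters.t * (letters.t * letters.t) + letters.gCorr := by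
    rw [CobarLetters.g]
    abel
  have hfe := ((Rep.of_mem hf).add ht).inj (g := e) (by
    rw [hg]
    exact hsum ▸ h)
  have hd : f - gen (Gen.t 0) * gen (Gen.t 1) * gen (Gen.t 2) * gen (Gen.t 3) = e := by
    rw [← hfe]
    simp only [map_mul, shift_comp, shift_t]
    grind
  rw [hd]
  exact he

/-! ### The Massey products -/

/-- Scalars of `𝔽₂`, as elements `0` or `1` of the ring. -/
theorem exists_coeff (α : ZMod 2) :
    ∃ e : Cobar, (e = 0 ∨ e = 1) ∧ ∀ z : Cobar, α • z = e * z := by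
  obtain rfl | rfl : α = 0 ∨ α = 1 := by revert α; decide
  · exact ⟨0, .inl rfl, fun z => by rw [zero_smul, zero_mul]⟩
  · exact ⟨1, .inr rfl, fun z => by rw [one_smul, one_mul]⟩

theorem smul_mul_cobar (α : ZMod 2) (z w : Cobar) : (α • z) * w = α • (z * w) := by
  obtain rfl | rfl : α = 0 ∨ α = 1 := by revert α; decide
  · rw [zero_smul, zero_smul, zero_mul]
  · rw [one_smul, one_smul]

theorem mul_smul_cobar (α : ZMod 2) (z w : Cobar) : z * (α • w) = α • (z * w) := by
  obtain rfl | rfl : α = 0 ∨ α = 1 := by revert α; decide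
  · rw [zero_smul, zero_smul, mul_zero]
  · rw [one_smul, one_smul]

theorem diff_smul (α : ZMod 2) (z : Cobar) : diff (α • z) = α • diff z := by
  obtain rfl | rfl : α = 0 ∨ α = 1 := by revert α; decide
  · rw [zero_smul, zero_smul, map_zero]
  · rw [one_smul, one_smul]

/-- Two bihomogeneous cocycles of degree one in the same class differ by the coboundary of a
homogeneous cochain. -/
theorem exists_homog_of_cls_eq {m : ℕ} {z w : Cobar} (hz : z ∈ bicochains 1 m)
    (hw : w ∈ bicochains 1 m) {hdz : diff z = 0} {hdw : diff w = 0} (h : cls z hdz = cls w hdw) :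
    ∃ v, Homog m v ∧ z = w + diff v := by
  obtain ⟨v, hv⟩ := (cls_eq_iff hdz hdw).1 h
  rw [sub_eq_add] at hv
  obtain ⟨v', hv', h'⟩ := exists_homog_of_eq_diff (add_mem_bicochains hz hw) hv
  exact ⟨v', hv', by rw [h', add_left_comm, add_self_zero, add_zero]⟩

theorem diff_a_mul (z : Cobar) : diff (letters.a * z) = letters.a * diff z := by
  rw [diff_mul, letters.diff_a, zero_mul, zero_add]

theorem diff_eight (α β : ZMod 2) :
    diff (α • (letters.a * (letters.a * (letters.a * letters.a))) + β • (letters.a * letters.c)) =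
      β • (letters.a * (letters.a * letters.r)) := by
  simp only [map_add, diff_smul, diff_a_mul, letters.diff_a, letters.diff_c, mul_zero, smul_zero,
    zero_add]

theorem diff_twelve (α β γ : ZMod 2) :
    diff (α • (letters.a * (letters.a * (letters.a * (letters.a * (letters.a * letters.a))))) +
      β • (letters.a * (letters.a * (letters.a * letters.c))) + γ • (letters.c * letters.c)) =
    β • (letters.a * (letters.a * (letters.a * (letters.a * letters.r)))) +
      γ • (letters.a * (letters.a * letters.X)) := by
  simp only [map_add, diff_smul, diff_a_mul, letters.diff_a, letters.diff_c, letters.diff_c_sq,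
    mul_zero, smul_zero, zero_add, mul_assoc]

theorem Coh.a₁_sq_eq : Coh.a₁ ^ 2 = cls (letters.a * letters.a)
    (diff_mul_eq_zero letters.diff_a letters.diff_a) := by
  rw [pow_two, Coh.a₁_eq, cls_mul]

/-- The Massey product `⟨x, a₁², h₂⟩` has at most one element. -/
theorem eq_yRep_of_mem_massey {ζ : H}
    (hζ : ζ ∈ massey Coh.x (Coh.a₁ ^ 2) Coh.h₂ (1, 8) (0, 4) (1, 4)) :
    ζ = cls letters.yRep letters.diff_yRep := by
  obtain ⟨p, q, r, hp, hq, hr, bp, bq, br, cp, cq, cr, u, bu, v, bv, hu, hv, hw, rfl⟩ := hζ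
  rw [Coh.x_eq] at cp
  rw [Coh.a₁_sq_eq] at cq
  obtain ⟨ε, rfl⟩ : ∃ ε : ZMod 2,
      p = letters.X + ε • (letters.a * (letters.a * letters.r)) := by
    obtain ⟨w, hom, rfl⟩ := exists_homog_of_cls_eq bp grading.X_mem cp
    obtain ⟨α, ε, rfl⟩ := hom.eight
    exact ⟨ε, by rw [diff_eight]⟩
  -- The representative of `a₁²` is unique, since there are no coboundaries of degree zero.
  obtain rfl : q = letters.a * letters.a := by
    obtain ⟨w, hw⟩ := (cls_eq_iff _ _).1 cq
    obtain ⟨f, hf, -, h⟩ := add_mem_bicochains bq (mul_mem_bicochains letters_a_mem letters_a_mem)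
    rw [← sub_eq_add] at h
    exact sub_eq_zero.1 (eq_zero_of_eq_diff ⟨hf, h⟩ hw)
  -- The representative of `h₂` is unique, since all cochains of bidegree `(0, 4)` are
  -- multiples of the cocycle `a₁²`.
  obtain rfl : r = letters.r := by
    obtain ⟨w, hom, rfl⟩ := exists_homog_of_cls_eq br grading.r_mem cr
    obtain ⟨α, rfl⟩ := hom.four
    rw [diff_smul, diff_a_mul, letters.diff_a, mul_zero, smul_zero, add_zero]
  obtain ⟨α, β, γ, rfl⟩ := (homog_of_mem_bicochains bu).twelve
  obtain ⟨α', β', rfl⟩ := (homog_of_mem_bicochains bv).eight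
  -- The equation `d u = a₁² x` determines the coefficients of `a₁³ a₃` and `a₃²` in `u`.
  obtain ⟨rfl, rfl⟩ : β = ε ∧ γ = 1 := by
    have h : (β + ε) • (letters.a * (letters.a * (letters.a * (letters.a * letters.r)))) +
        (γ + 1) • (letters.a * (letters.a * letters.X)) = 0 := by
      rw [diff_twelve, add_mul, smul_mul_cobar] at hu
      simp only [letters.mul_a, mul_assoc, letters.mul_a_mul] at hu
      rw [add_smul, add_smul, one_smul, add_add_add_comm, hu,
        add_comm (letters.a * (letters.a * letters.X)), add_self_zero]
    obtain ⟨h1, h2⟩ := smul_letters_r_add_smul_X h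
    exact ⟨CharTwo.add_eq_zero.1 h1, CharTwo.add_eq_zero.1 h2⟩
  -- The equation `d v = a₁² h₂` determines the coefficient of `a₁ a₃` in `v`.
  obtain rfl : β' = 1 := by
    have h : (β' + 1) • (letters.a * (letters.a * (letters.a * (letters.a * letters.r)))) +
        (0 : ZMod 2) • (letters.a * (letters.a * letters.X)) = 0 := by
      rw [diff_eight] at hv
      have hv' := congrArg (fun z => letters.a * (letters.a * z)) hv
      simp only [mul_smul_cobar, mul_assoc] at hv'
      rw [add_smul, one_smul, zero_smul, add_zero, hv', add_self_zero]
    exact CharTwo.add_eq_zero.1 (smul_letters_r_add_smul_X h).1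
  obtain ⟨e, he, hes⟩ := exists_coeff β
  obtain ⟨k, hk, hks⟩ := exists_coeff α
  obtain ⟨l, hl, hls⟩ := exists_coeff α'
  refine cls_eq _ _ (Eq.trans ?_ (letters.massey_x_a_sq_r he hk hl))
  simp only [hes, hks, hls, one_smul]

theorem massey_x_a_sq_h₂ : massey Coh.x (Coh.a₁ ^ 2) Coh.h₂ (1, 8) (0, 4) (1, 4) =
    {cls letters.yRep letters.diff_yRep} := by
  refine Set.eq_singleton_iff_unique_mem.2 ⟨?_, fun ζ => eq_yRep_of_mem_massey⟩
  have haa : letters.a * letters.a ∈ bicochains 0 4 :=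
    (mul_mem_bicochains letters_a_mem letters_a_mem :)
  have hu : letters.c * letters.c ∈ bicochains 0 12 :=
    (mul_mem_bicochains letters_c_mem letters_c_mem :)
  have hv : letters.a * letters.c ∈ bicochains 0 8 :=
    (mul_mem_bicochains letters_a_mem letters_c_mem :)
  refine ⟨letters.X, letters.a * letters.a, letters.r, letters.diff_X,
    diff_mul_eq_zero letters.diff_a letters.diff_a, letters.diff_r, grading.X_mem, haa,
    letters_r_mem, Coh.x_eq.symm, Coh.a₁_sq_eq.symm, Coh.h₂_eq.symm, letters.c * letters.c, hu,
    letters.a * letters.c, hv, ?_, ?_, letters.diff_yRep, rfl⟩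
  · rw [letters.diff_c_sq, mul_assoc, letters.mul_a_mul letters.X, letters.mul_a letters.X]
  · rw [letters.diff_a_mul_c, mul_assoc]

theorem yRep_mul_h₁ :
    cls letters.yRep letters.diff_yRep * Coh.h₁ = Coh.a₁ * Coh.d := by
  rw [Coh.d, pow_two, ← mul_assoc, Coh.x_eq, Coh.a₁_eq, Coh.h₁_eq, cls_mul, cls_mul, cls_mul]
  exact cls_eq _ _ letters.yRep_mul_s

/-- The class of `g`. -/
noncomputable def Coh.g : H := cls letters.g letters.diff_g

theorem a₁_pow_four_mul_g : Coh.a₁ ^ 4 * Coh.g = Coh.Δ * Coh.h₁ ^ 4 := by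
  have ha : Coh.a₁ ^ 4 = cls (letters.a ^ 4) (diff_pow_eq_zero letters.diff_a 4) := by
    rw [Coh.a₁_eq, cls_pow]
  have hs : Coh.h₁ ^ 4 = cls (letters.s ^ 4) (diff_pow_eq_zero letters.diff_s 4) := by
    rw [Coh.h₁_eq, cls_pow]
  rw [ha, hs, Coh.Δ_eq, Coh.g, cls_mul, cls_mul]
  exact cls_eq _ _ letters.a_pow_four_mul_g

theorem g_mul_a₁_sq_mem_massey :
    Coh.g * Coh.a₁ ^ 2 ∈ massey Coh.h₁ (Coh.d * Coh.h₁) Coh.x (1, 2) (3, 18) (1, 8) := by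
  have hb : diff (letters.s * letters.X * letters.X) = 0 :=
    diff_mul_eq_zero (diff_mul_eq_zero letters.diff_s letters.diff_X) letters.diff_X
  have hdb : cls _ hb = Coh.d * Coh.h₁ := by
    rw [← cls_mul (diff_mul_eq_zero letters.diff_s letters.diff_X) letters.diff_X,
      ← cls_mul letters.diff_s letters.diff_X, ← Coh.x_eq, ← Coh.h₁_eq, Coh.d, pow_two,
      Coh.h₁_mul_x, mul_assoc, Coh.h₁_mul_x, mul_assoc]
  have hz := letters.u_mul_X_add_s_mul_v_eq
  have hdz : diff (letters.u * letters.X + letters.s * letters.v) = 0 := by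
    rw [hz, map_add, diff_diff, add_zero]
    exact diff_mul_eq_zero (diff_mul_eq_zero letters.diff_a letters.diff_a) letters.diff_g
  have hsXX : letters.s * letters.X * letters.X ∈ bicochains 3 18 :=
    (mul_mem_bicochains (mul_mem_bicochains letters_s_mem grading.X_mem) grading.X_mem :)
  refine ⟨letters.s, letters.s * letters.X * letters.X, letters.X, letters.diff_s, hb,
    letters.diff_X, letters_s_mem, hsXX, grading.X_mem, Coh.h₁_eq.symm, hdb, Coh.x_eq.symm,
    letters.u, grading.u_mem, letters.v, grading.v_mem, ?_, letters.diff_v, hdz, ?_⟩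
  · rw [letters.diff_u]
    simp only [mul_assoc]
  · rw [Coh.g, Coh.a₁_sq_eq, cls_mul]
    refine cls_eq (w := letters.zLead + letters.a * letters.zCorr) _ _ (hz.trans ?_)
    rw [letters.mul_a_mul letters.g, letters.mul_a letters.g, mul_assoc]

end EllCobar

theorem mainTheorem6 :
    Coh.x * Coh.h₂ = Coh.a₁ * Coh.x * Coh.h₁ ∧
    Coh.d * Coh.h₂ = Coh.a₁ * Coh.d * Coh.h₁ ∧
    (∃ y : H, massey Coh.x (Coh.a₁ ^ 2) Coh.h₂ (1, 8) (0, 4) (1, 4) = {y} ∧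
      y * Coh.h₁ = Coh.a₁ * Coh.d) ∧
    (∃ g : H, Coh.IsLiftOfGenerator g ∧
      Coh.a₁ ^ 4 * g = Coh.Δ * Coh.h₁ ^ 4 ∧
      g * Coh.a₁ ^ 2 ∈ massey Coh.h₁ (Coh.d * Coh.h₁) Coh.x (1, 2) (3, 18) (1, 8)) := by
  exact ⟨Coh.x_mul_h₂, Coh.d_mul_h₂, ⟨_, massey_x_a_sq_h₂, yRep_mul_h₁⟩,
    Coh.g, isLiftOfGenerator_g, a₁_pow_four_mul_g, g_mul_a₁_sq_mem_massey⟩
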